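/- Let $\omega_1\in\mathbb C\setminus\{0\}$, $\Omega=\mathbb Z\omega_1$ and $\Omega'=\Omega\setminus\{0\}$. A formal series $\widetilde\varphi=\sum_{n\ge0}c_nz^{-n}\in\mathbb C[[z^{-1}]]$ is called simple $\Omega$-resurgent if its Borel transform $\widehat\varphi(\zeta)=\sum_{n\ge0}c_{n+1}\zeta^n/n!$ has positive radius of convergence, has an analytic continuation along every path that starts close enough to $0$ and avoids $\Omega$, and all branches have at worst simple singularities: if $\gamma$ is such a path, with endpoint $\zeta_1$, and $\omega$ is a point of $\Omega$ nearest to $\zeta_1$, then the continuation $\operatorname{cont}_\gamma\widehat\varphi$, followed along $[\zeta_1,\omega[$, satisfies near $\omega$ $$\operatorname{cont}_\gamma\widehat\varphi(\omega+\xi)=\frac{a_0}{2\pi i\,\xi}+\widehat\chi(\xi)\frac{\log\xi}{2\pi i}+F(\xi),\qquad a_0\in\mathbb C,\quad \widehat\chi,F \text{ analytic at } 0 .$$ These series form a $\mathbb C$-vector space $\widetilde{\mathcal R}^{\rm s}_\Omega$. One writes $\mathcal A^\gamma_\omega\widetilde\varphi$ for the series with constant term $a_0$ and Borel transform $\widehat\chi$.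 For $\omega\in\Omega'$ write $\omega=r\eta$ with $\eta\in\{\omega_1,-\omega_1\}$ and $r\ge1$, and fix $\delta\in(0,\frac12)$. For $\varepsilon\in\{+,-\}^{r-1}$ let $\gamma(\varepsilon)$ be the path from $\delta\eta$ to $(r-\delta)\eta$ that follows $]0,\omega[$ except that each $k\eta$, $1\le k\le r-1$, is circumvented to the right if $\varepsilon_k=+$ and to the left if $\varepsilon_k=-$. The alien derivation of index $\omega$ is $$\Delta_\omega=\sum_{\varepsilon\in\{+,-\}^{r-1}}\frac{p(\varepsilon)!\,q(\varepsilon)!}{r!}\,\mathcal A_\omega^{\gamma(\varepsilon)},$$ where $p(\varepsilon)$ and $q(\varepsilon)$ are the numbers of signs $+$ and $-$ in $\varepsilon$. Theorem. The formula above gives, for each $\omega\in\Omega'$, a well-defined $\mathbb C$-linear operator $\Delta_\omega\colon\widetilde{\mathcal R}^{\rm s}_\Omega\to\widetilde{\mathcal R}^{\rm s}_\Omega$, and these operators have the following properties. 1. Let $(\Phi^{w})_w$ be a finitely supported family of elements of $\widetilde{\mathcal R}^{\rm s}_\Omega$, indexed by all words $w=\omega_1\cdots\omega_r$ ($r\ge0$)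 on the alphabet $\Omega'$. If the $\Phi^w$ are not all zero, then the operator $\widetilde\varphi\mapsto\sum_{w}\Phi^{w}\,\Delta_{w}\widetilde\varphi$ on $\widetilde{\mathcal R}^{\rm s}_\Omega$ is nonzero. Here $\Delta_w=\Delta_{\omega_r}\cdots\Delta_{\omega_1}$, $\Delta_\varnothing=\mathrm{Id}$, and the products with $\Phi^w$ are products of formal series. That is, the products $\Delta_w$ are linearly independent with coefficients, on the left, in $\widetilde{\mathcal R}^{\rm s}_\Omega$. 2. The associative subalgebra of $\operatorname{End}_{\mathbb C}(\widetilde{\mathcal R}^{\rm s}_\Omega)$ generated by the $\Delta_\omega$ is free on them: the canonical morphism from the free associative $\mathbb C$-algebra on $\Omega'$ is injective. 3. The Lie subalgebra (for the commutator) of $\operatorname{End}_{\mathbb C}(\widetilde{\mathcal R}^{\rm s}_\Omega)$ generated by the $\Delta_\omega$ is free on them: the canonical morphism from the free Lie algebra $\mathcal L$ over $\mathbb C$ on $\Omega'$ is injective. Moreover the $\mathbb C$-linear map that sends $\widetilde c\otimes\ell\in\widetilde{\mathcal R}^{\rm s}_\Omega\otimes_{\mathbb C}\mathcal L$ to the operator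 $\widetilde\varphi\mapsto\widetilde c\cdot D_\ell\widetilde\varphi$ is injective, where $D_\ell$ is the image of $\ell$. -/

import Mathlib

open scoped Topology TensorProduct

noncomputable section

namespace Resurgence

/-! Formal series in `z⁻¹` are elements of `PowerSeries ℂ`, the variable standing for `z⁻¹`.
The rank-one lattice is `Ω = ℤ ω₁`, i.e. `AddSubgroup.zmultiples ω₁` with `ω₁ ≠ 0`. -/

/-- The general term `c_{n+1} ζⁿ / n!` of the Borel transform of `∑ c_n z⁻ⁿ`. -/
def borelTerm (φ : PowerSeries ℂ) (ζ : ℂ) (n : ℕ) : ℂ :=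
  PowerSeries.coeff (n + 1) φ * ζ ^ n / (n.factorial : ℂ)

/-- The Borel transform `φ̂(ζ) = ∑ c_{n+1} ζⁿ / n!`, used inside its disc of convergence. -/
def borelTransform (φ : PowerSeries ℂ) (ζ : ℂ) : ℂ := ∑' n, borelTerm φ ζ n

/-- The formal series whose image under the (full) Borel transform is `a δ + χ`,
for `χ` analytic at `0`. -/
def invBorel (a : ℂ) (χ : ℂ → ℂ) : PowerSeries ℂ :=
  PowerSeries.mk fun n => Nat.casesOn n a fun k => iteratedDeriv k χ 0

/-- `f` is an analytic continuation of `φ` along the path `γ : [a, b] → ℂ`: `f t` is an analytic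
germ at `γ t`, it starts as the germ of `φ`, and it varies in a locally consistent way.
The final germ is `f b`. -/
structure IsContinuation (φ : ℂ → ℂ) (γ : ℝ → ℂ) (a b : ℝ) (f : ℝ → ℂ → ℂ) : Prop where
  analytic : ∀ t ∈ Set.Icc a b, AnalyticAt ℂ (f t) (γ t)
  start : f a =ᶠ[𝓝 (γ a)] φ
  compat : ∀ t ∈ Set.Icc a b, ∀ᶠ s in 𝓝[Set.Icc a b] t, f s =ᶠ[𝓝 (γ s)] f t

/-- The germ `G` at `ζ₁` extends holomorphically to the open disc centred at `ζ₁` with `ω` on its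
boundary and has there at worst a simple singularity at `ω`, with singular data `(a, χ)`:
`G(ω + ξ) = a / (2πi ξ) + χ(ξ) log ξ / (2πi) + F(ξ)` with `χ`, `F` analytic at `0`.
For `ω + ξ` in that disc `ξ / (ζ₁ - ω)` has positive real part, so that
`Complex.log (ξ / (ζ₁ - ω)) + Complex.log (ζ₁ - ω)` is a holomorphic branch of `log ξ`; another
branch would only modify `F`. -/
def HasSimpleSing (G : ℂ → ℂ) (ζ₁ ω a : ℂ) (χ : ℂ → ℂ) : Prop :=
  AnalyticAt ℂ χ 0 ∧
  ∃ g F : ℂ → ℂ,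
    DifferentiableOn ℂ g (Metric.ball ζ₁ (dist ζ₁ ω)) ∧ g =ᶠ[𝓝 ζ₁] G ∧ AnalyticAt ℂ F 0 ∧
    ∀ᶠ ξ in 𝓝 (0 : ℂ), ω + ξ ∈ Metric.ball ζ₁ (dist ζ₁ ω) →
      g (ω + ξ) = a / (2 * Real.pi * Complex.I * ξ)
        + χ ξ * ((Complex.log (ξ / (ζ₁ - ω)) + Complex.log (ζ₁ - ω)) / (2 * Real.pi * Complex.I))
        + F ξ

/-- `ω` is a point of `Ω = ℤ ω₁` nearest to `ζ`. -/
def IsNearest (ω₁ ζ ω : ℂ) : Prop :=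
  ω ∈ AddSubgroup.zmultiples ω₁ ∧ ∀ ω' ∈ AddSubgroup.zmultiples ω₁, dist ζ ω ≤ dist ζ ω'

/-- With `ρ` as the meaning of 'close enough to `0`': the Borel transform converges in the disc of
radius `ρ`, has an analytic continuation along every path that starts in this disc and avoids `Ω`,
and every branch so obtained has at worst simple singularities. -/
def IsSimpleResurgentWith (ω₁ : ℂ) (φ : PowerSeries ℂ) (ρ : ℝ) : Prop :=
  (∀ ζ ∈ Metric.ball (0 : ℂ) ρ, Summable (borelTerm φ ζ)) ∧
  ∀ (γ : ℝ → ℂ) (a b : ℝ), a ≤ b → ContinuousOn γ (Set.Icc a b) →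
    (∀ t ∈ Set.Icc a b, γ t ∉ AddSubgroup.zmultiples ω₁) → γ a ∈ Metric.ball (0 : ℂ) ρ →
    ∃ f, IsContinuation (borelTransform φ) γ a b f ∧
      ∀ ω, IsNearest ω₁ (γ b) ω → ∃ a₀ χ, HasSimpleSing (f b) (γ b) ω a₀ χ

theorem IsSimpleResurgentWith.mono {ω₁ : ℂ} {φ : PowerSeries ℂ} {ρ ρ' : ℝ}
    (h : IsSimpleResurgentWith ω₁ φ ρ) (hρ : ρ' ≤ ρ) : IsSimpleResurgentWith ω₁ φ ρ' :=
  ⟨fun ζ hζ => h.1 ζ (Metric.ball_subset_ball hρ hζ), fun γ a b hab hγ hΩ h0 =>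
    h.2 γ a b hab hγ hΩ (Metric.ball_subset_ball hρ h0)⟩

theorem borelTerm_add (φ ψ : PowerSeries ℂ) (ζ : ℂ) :
    borelTerm (φ + ψ) ζ = fun n => borelTerm φ ζ n + borelTerm ψ ζ n := by
  funext n; simp [borelTerm]; ring

theorem borelTerm_smul (c : ℂ) (φ : PowerSeries ℂ) (ζ : ℂ) :
    borelTerm (c • φ) ζ = fun n => c * borelTerm φ ζ n := by
  funext n; simp [borelTerm]; ring

theorem IsSimpleResurgentWith.add {ω₁ : ℂ} {φ ψ : PowerSeries ℂ} {ρ : ℝ}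
    (hφ : IsSimpleResurgentWith ω₁ φ ρ) (hψ : IsSimpleResurgentWith ω₁ ψ ρ) :
    IsSimpleResurgentWith ω₁ (φ + ψ) ρ := by
  refine ⟨fun ζ hζ => ?_, fun γ a b hab hγ hΩ h0 => ?_⟩
  · rw [borelTerm_add]
    exact (hφ.1 ζ hζ).add (hψ.1 ζ hζ)
  · obtain ⟨f, hf, hfs⟩ := hφ.2 γ a b hab hγ hΩ h0
    obtain ⟨g, hg, hgs⟩ := hψ.2 γ a b hab hγ hΩ h0
    refine ⟨fun t => f t + g t, ⟨fun t ht => (hf.analytic t ht).add (hg.analytic t ht), ?_,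
      fun t ht => ?_⟩, fun ω hω => ?_⟩
    · filter_upwards [hf.start, hg.start, Metric.isOpen_ball.mem_nhds h0] with ζ h1 h2 h3
      have : borelTransform (φ + ψ) ζ = borelTransform φ ζ + borelTransform ψ ζ := by
        simp only [borelTransform, borelTerm_add]
        exact (hφ.1 ζ h3).tsum_add (hψ.1 ζ h3)
      simp [this, h1, h2]
    · filter_upwards [hf.compat t ht, hg.compat t ht] with s h1 h2
      exact h1.add h2
    · obtain ⟨a₁, χ₁, hχ₁, u₁, F₁, hu₁, he₁, hF₁, hs₁⟩ := hfs ω hω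
      obtain ⟨a₂, χ₂, hχ₂, u₂, F₂, hu₂, he₂, hF₂, hs₂⟩ := hgs ω hω
      refine ⟨a₁ + a₂, χ₁ + χ₂, hχ₁.add hχ₂, u₁ + u₂, F₁ + F₂, hu₁.add hu₂, he₁.add he₂,
        hF₁.add hF₂, ?_⟩
      filter_upwards [hs₁, hs₂] with ξ h1 h2 hξ
      simp only [Pi.add_apply, h1 hξ, h2 hξ]
      ring

theorem IsSimpleResurgentWith.smul {ω₁ : ℂ} {φ : PowerSeries ℂ} {ρ : ℝ}
    (c : ℂ) (hφ : IsSimpleResurgentWith ω₁ φ ρ) : IsSimpleResurgentWith ω₁ (c • φ) ρ := by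
  refine ⟨fun ζ hζ => ?_, fun γ a b hab hγ hΩ h0 => ?_⟩
  · rw [borelTerm_smul]
    exact (hφ.1 ζ hζ).mul_left c
  · obtain ⟨f, hf, hfs⟩ := hφ.2 γ a b hab hγ hΩ h0
    refine ⟨fun t ζ => c * f t ζ,
      ⟨fun t ht => analyticAt_const.mul (hf.analytic t ht), ?_, fun t ht => ?_⟩, fun ω hω => ?_⟩
    · filter_upwards [hf.start] with ζ h1
      simp only [h1, borelTransform, borelTerm_smul, tsum_mul_left]
    · filter_upwards [hf.compat t ht] with s h1
      filter_upwards [h1] with ζ h2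
      rw [h2]
    · obtain ⟨a₁, χ₁, hχ₁, u₁, F₁, hu₁, he₁, hF₁, hs₁⟩ := hfs ω hω
      refine ⟨c * a₁, fun ξ => c * χ₁ ξ, analyticAt_const.mul hχ₁, fun ξ => c * u₁ ξ,
        fun ξ => c * F₁ ξ, hu₁.const_mul c, ?_, analyticAt_const.mul hF₁, ?_⟩
      · filter_upwards [he₁] with ζ h1
        rw [h1]
      · filter_upwards [hs₁] with ξ h1 hξ
        simp only [h1 hξ]
        ring

theorem isSimpleResurgentWith_zero (ω₁ : ℂ) : IsSimpleResurgentWith ω₁ 0 1 := by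
  have h0 : borelTransform 0 = fun _ => 0 := by
    funext ζ
    simp [borelTransform, borelTerm]
  refine ⟨fun ζ _ => ?_, fun γ a b _ _ _ _ => ⟨fun _ _ => 0, ⟨fun _ _ => analyticAt_const, ?_,
    fun _ _ => Filter.Eventually.of_forall fun _ => Filter.EventuallyEq.rfl⟩, fun ω _ =>
      ⟨0, fun _ => 0, analyticAt_const, fun _ => 0, fun _ => 0,
        differentiableOn_const 0, Filter.EventuallyEq.rfl, analyticAt_const, ?_⟩⟩⟩
  · have : borelTerm 0 ζ = fun _ => 0 := by
      funext n
      simp [borelTerm]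
    rw [this]
    exact summable_zero
  · rw [h0]
  · exact Filter.Eventually.of_forall fun ξ _ => by simp

/-- The space of simple `Ω`-resurgent series, `Ω = ℤ ω₁`. -/
def SimpleResurgent (ω₁ : ℂ) : Submodule ℂ (PowerSeries ℂ) where
  carrier := {φ | ∃ ρ > 0, IsSimpleResurgentWith ω₁ φ ρ}
  zero_mem' := ⟨1, one_pos, isSimpleResurgentWith_zero ω₁⟩
  add_mem' := by
    rintro φ ψ ⟨ρ, hρ, h⟩ ⟨ρ', hρ', h'⟩
    exact ⟨min ρ ρ', lt_min hρ hρ', (h.mono (min_le_left _ _)).add (h'.mono (min_le_right _ _))⟩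
  smul_mem' := by
    rintro c φ ⟨ρ, hρ, h⟩
    exact ⟨ρ, hρ, h.smul c⟩

/-- `ψ` is the image of `φ` under the alien operator `𝒜_ω^γ` attached to the path
`γ : [a, b] → ℂ`. -/
def IsAlienImage (γ : ℝ → ℂ) (a b : ℝ) (ω : ℂ) (φ ψ : PowerSeries ℂ) : Prop :=
  ∃ (f : ℝ → ℂ → ℂ) (a₀ : ℂ) (χ : ℂ → ℂ),
    IsContinuation (borelTransform φ) γ a b f ∧ HasSimpleSing (f b) (γ b) ω a₀ χ ∧ ψ = invBorel a₀ χ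

/-- The path `γ(ε)`, on the parameter interval `[δ, m + 1 - δ]`: it follows the direction of `η`,
except that `k η` (`1 ≤ k ≤ m`) is circumvented along the half-circle of radius `δ |η|`, to the
right if the `k`-th sign is `+` (coded by `true`) and to the left otherwise. Here
`Real.sqrt` vanishes on negative numbers, i.e. away from these half-circles, and `-i η` points to
the right of the direction `η`. -/
def crossingPath (η : ℂ) (δ : ℝ) {m : ℕ} (ε : Fin m → Bool) (x : ℝ) : ℂ :=
  η * ((x : ℂ) - Complex.I *
    ((∑ k : Fin m, (if ε k then 1 else -1) * Real.sqrt (δ ^ 2 - (x - ((k : ℕ) + 1)) ^ 2) : ℝ) : ℂ))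

/-- The weight `p! q! / (m + 1)!`, where `p` and `q` are the numbers of signs `+` and `-`. -/
def weight {m : ℕ} (ε : Fin m → Bool) : ℂ :=
  ((Finset.univ.filter fun k => ε k = true).card.factorial : ℂ) *
    ((Finset.univ.filter fun k => ε k = false).card.factorial : ℂ) / ((m + 1).factorial : ℂ)

/-- The alphabet `Ω' = Ω ∖ {0}`. -/
abbrev Letter (ω₁ : ℂ) : Type := {ω : ℂ // ω ∈ AddSubgroup.zmultiples ω₁ ∧ ω ≠ 0}

/-- `ψ = Δ_ω φ` for `ω ∈ Ω'`: writing `ω = (m + 1) η` with `η = ω₁` or `η = -ω₁`,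
`Δ_ω` is the weighted sum of the alien operators of the `2 ^ m` paths `γ(ε)`. -/
def IsAlienDerivative (ω₁ : ℂ) (δ : ℝ) (ω : Letter ω₁) (φ ψ : PowerSeries ℂ) : Prop :=
  ∃ (η : ℂ) (m : ℕ) (θ : (Fin m → Bool) → PowerSeries ℂ),
    (η = ω₁ ∨ η = -ω₁) ∧ (ω : ℂ) = (m + 1) * η ∧
    (∀ ε : Fin m → Bool, IsAlienImage (crossingPath η δ ε) δ (m + 1 - δ) ω φ (θ ε)) ∧
    ψ = ∑ ε : Fin m → Bool, weight ε • θ ε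

/-- `Δ_{ω_r} ⋯ Δ_{ω_1}` for the word `ω_1 ⋯ ω_r` (`Δ_{ω_1}` acts first); the identity for the
empty word. -/
def wordOp {L V : Type*} [AddCommGroup V] [Module ℂ V] (D : L → Module.End ℂ V)
    (w : List L) : Module.End ℂ V :=
  (w.reverse.map D).prod

/-- The operator `φ ↦ c · T φ` for `c` simple resurgent and `T` an endomorphism; the product is
that of formal series. -/
def leftMul {ω₁ : ℂ} : SimpleResurgent ω₁ →ₗ[ℂ] Module.End ℂ (SimpleResurgent ω₁) →ₗ[ℂ]
    (SimpleResurgent ω₁ →ₗ[ℂ] PowerSeries ℂ) :=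
  LinearMap.mk₂ ℂ
    (fun c T => LinearMap.mulLeft ℂ (c : PowerSeries ℂ) ∘ₗ (SimpleResurgent ω₁).subtype ∘ₗ T)
    (fun c c' T => by ext1 φ; simp [add_mul])
    (fun a c T => by ext1 φ; simp)
    (fun c T T' => by ext1 φ; simp [mul_add])
    (fun a c T => by ext1 φ; simp)

/-- The mould expansion `∑_w Φ^w Δ_w`. -/
def mouldExpansion {ω₁ : ℂ} (D : Letter ω₁ → Module.End ℂ (SimpleResurgent ω₁))
    (Φ : List (Letter ω₁) →₀ SimpleResurgent ω₁) : SimpleResurgent ω₁ →ₗ[ℂ] PowerSeries ℂ :=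
  Φ.sum fun w c => leftMul c (wordOp D w)

end Resurgence

end

/-! Associative algebras carry the commutator bracket. -/
attribute [local instance] LieRing.ofAssociativeRing

/-!
Linear independence of the words `Δ_w` over the simple resurgent series follows from the existence
of simple resurgent series on which they act triangularly. These are the monomials `V^w`
(`monomial`), given by `V^∅ = 1` and `(ζ - (x + ŵ)) V̂^{x w}(ζ) = V^w₀ + ∫₀^ζ V̂^w`, where `ŵ` is
the sum of the letters of `w`; their Borel transforms are hyperlogarithms. An alien operator
commutes with `z⁻¹`, that is with integration in the Borel plane, and turns multiplication by
`ζ - c` into multiplication by `ζ + ω - c`. So `Δ_ω V^w` solves the same kind of recursion as `V^w`,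
and one finds `Δ_ω V^w = ∑ C_ω(v) V^u`, the sum over the factorizations `w = u v` with `v ≠ ∅`,
where the constants `C_ω(v)` vanish unless `v̂ = ω` (`alienDerivation_monomial`); moreover
`C_ω(ω) ≠ 0`, because `V̂^ω = 1 / (ζ - ω)` and the weights of the paths are positive. Each alien
derivation thus removes a nonempty suffix, and on words of length at most `|w|` the operator `Δ_w`
annihilates every `V^u` except for the mirror image `u` of `w`, which it sends to a nonzero
constant (`wordOp_monomial`). For a family `Φ ≠ 0`, evaluation at the mirror image of a word `v`
of minimal length with `Φ^v ≠ 0` leaves a nonzero multiple of `Φ^v`.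

The operators exist for the following reasons. A simple singularity determines its data `(a, χ)`,
because the logarithm is transcendental over the meromorphic germs (`HasSimpleSing.unique`). The
Borel transform of a simple resurgent series is holomorphic in the disc of radius `|ω₁|`
(`IsSimpleResurgentWith.norm_period`), where the paths of the alien derivations start. The
function `χ` is a difference of two branches that differ by a turn around `ω`, so that it can be
continued in the same way and has simple singularities (`IsBranch.invBorel_mem`).

The monomials are simple resurgent because the residues of all branches of `V̂^w` are located at
the single point `ŵ`: the factor of the logarithm in the integral vanishes at every other point of
the lattice, and division by `ζ - (x + ŵ)`, with `x ≠ 0`, creates only simple singularities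
(`exists_isHyperlogStep`, `IsHyperlogStep.residuesOnlyAt`).

The statements on the free associative algebra and on the free Lie algebra reduce to the
independence of words. The free Lie algebra embeds into the free associative algebra in
characteristic zero, by the argument of Dynkin, Specht and Wever: right bracketing restricts to
the derivation that multiplies an element of degree `n` by `n`
(`FreeLieAlgebra.lift_ι_injective`).
-/

namespace Resurgence

open Metric Set Filter

/-! ### Continuation along paths -/

theorem eventually_eventuallyEq_iff {f g : ℂ → ℂ} {z : ℂ} (hf : AnalyticAt ℂ f z)
    (hg : AnalyticAt ℂ g z) : ∀ᶠ w in 𝓝 z, (f =ᶠ[𝓝 w] g ↔ f =ᶠ[𝓝 z] g) := by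
  obtain ⟨r, hr, hfr⟩ := hf.exists_ball_analyticOnNhd
  obtain ⟨s, hs, hgs⟩ := hg.exists_ball_analyticOnNhd
  filter_upwards [ball_mem_nhds z (lt_min hr hs)] with w hw
  have hf' : AnalyticOnNhd ℂ f (ball z (min r s)) := hfr.mono (ball_subset_ball (min_le_left _ _))
  have hg' : AnalyticOnNhd ℂ g (ball z (min r s)) := hgs.mono (ball_subset_ball (min_le_right _ _))
  have hc : IsPreconnected (ball z (min r s)) := (convex_ball _ _).isPreconnected
  exact ⟨fun h => (hf'.eqOn_of_preconnected_of_eventuallyEq hg' hc hw h).eventuallyEq_of_mem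
    (ball_mem_nhds z (lt_min hr hs)), fun h =>
    (hf'.eqOn_of_preconnected_of_eventuallyEq hg' hc (mem_ball_self (lt_min hr hs)) h
      ).eventuallyEq_of_mem (isOpen_ball.mem_nhds hw)⟩

namespace IsContinuation

variable {φ ψ : ℂ → ℂ} {γ γ' : ℝ → ℂ} {a b c : ℝ} {f f' : ℝ → ℂ → ℂ}

/-- Two continuations along a path that agree at one time agree at all times. -/
theorem unique (h : IsContinuation φ γ a b f) (h' : IsContinuation ψ γ a b f')
    (hγ : ContinuousOn γ (Icc a b)) {t₀ t : ℝ} (ht₀ : t₀ ∈ Icc a b) (ht : t ∈ Icc a b)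
    (h0 : f t₀ =ᶠ[𝓝 (γ t₀)] f' t₀) : f t =ᶠ[𝓝 (γ t)] f' t := by
  refine (isPreconnected_Icc.induction₂
    (fun s t => (f s =ᶠ[𝓝 (γ s)] f' s) ↔ (f t =ᶠ[𝓝 (γ t)] f' t)) (fun x hx => ?_)
    (fun x y z _ _ _ h1 h2 => h1.trans h2) (fun x y _ _ h1 => h1.symm) ht₀ ht).1 h0
  filter_upwards [h.compat x hx, h'.compat x hx, (hγ x hx).eventually
    (eventually_eventuallyEq_iff (h.analytic x hx) (h'.analytic x hx))] with s h1 h2 h3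
  rw [← h3]
  exact ⟨fun h => h1.trans (h.trans h2.symm), fun h => h1.symm.trans (h.trans h2)⟩

theorem unique_end (h : IsContinuation φ γ a b f) (h' : IsContinuation φ γ a b f')
    (hγ : ContinuousOn γ (Icc a b)) (hab : a ≤ b) : f b =ᶠ[𝓝 (γ b)] f' b :=
  h.unique h' hγ (left_mem_Icc.2 hab) (right_mem_Icc.2 hab) (h.start.trans h'.start.symm)

theorem const (h : ∀ t ∈ Icc a b, AnalyticAt ℂ φ (γ t)) : IsContinuation φ γ a b fun _ => φ :=
  ⟨h, EventuallyEq.rfl, fun _ _ => Eventually.of_forall fun _ => EventuallyEq.rfl⟩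

theorem congr_start (h : IsContinuation φ γ a b f) (hφ : φ =ᶠ[𝓝 (γ a)] ψ) :
    IsContinuation ψ γ a b f := ⟨h.analytic, h.start.trans hφ, h.compat⟩

theorem congr_path (h : IsContinuation φ γ a b f) (hab : a ≤ b) (hγ : EqOn γ γ' (Icc a b)) :
    IsContinuation φ γ' a b f := by
  refine ⟨fun t ht => hγ ht ▸ h.analytic t ht, hγ (left_mem_Icc.2 hab) ▸ h.start, fun t ht => ?_⟩
  filter_upwards [h.compat t ht, self_mem_nhdsWithin] with s hs hs'
  rwa [← hγ hs']

theorem left (h : IsContinuation φ γ a c f) (hbc : b ≤ c) : IsContinuation φ γ a b f :=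
  have hs : Icc a b ⊆ Icc a c := Icc_subset_Icc_right hbc
  ⟨fun t ht => h.analytic t (hs ht), h.start, fun t ht =>
    (h.compat t (hs ht)).filter_mono (nhdsWithin_mono _ hs)⟩

theorem right (h : IsContinuation φ γ a c f) (hab : a ≤ b) : IsContinuation (f b) γ b c f :=
  have hs : Icc b c ⊆ Icc a c := Icc_subset_Icc_left hab
  ⟨fun t ht => h.analytic t (hs ht), EventuallyEq.rfl, fun t ht =>
    (h.compat t (hs ht)).filter_mono (nhdsWithin_mono _ hs)⟩

theorem shift (h : IsContinuation φ γ a b f) (d : ℝ) :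
    IsContinuation φ (fun t => γ (t - d)) (a + d) (b + d) (fun t => f (t - d)) := by
  have hm : ∀ t ∈ Icc (a + d) (b + d), t - d ∈ Icc a b := fun t ht =>
    ⟨by linarith [ht.1], by linarith [ht.2]⟩
  refine ⟨fun t ht => h.analytic _ (hm t ht), by simpa using h.start, fun t ht => ?_⟩
  have : Tendsto (fun t : ℝ => t - d) (𝓝[Icc (a + d) (b + d)] t) (𝓝[Icc a b] (t - d)) :=
    ((continuous_id.sub continuous_const).continuousWithinAt).tendsto_nhdsWithin hm
  exact this.eventually (h.compat _ (hm t ht))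

theorem concat (h : IsContinuation φ γ a b f) (h' : IsContinuation (f b) γ b c f')
    (hγ : ContinuousOn γ (Icc a c)) (hab : a ≤ b) (hbc : b ≤ c) :
    IsContinuation φ γ a c (fun t => if t ≤ b then f t else f' t) := by
  refine ⟨fun t ht => ?_, by simpa [hab] using h.start, fun t ht => ?_⟩
  · by_cases htb : t ≤ b
    · simpa [htb] using h.analytic t ⟨ht.1, htb⟩
    · simpa [htb] using h'.analytic t ⟨(not_le.1 htb).le, ht.2⟩
  · rcases lt_trichotomy t b with htb | rfl | htb
    · have h1 := eventually_nhdsWithin_iff.1 (h.compat t ⟨ht.1, htb.le⟩)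
      filter_upwards [eventually_nhdsWithin_of_eventually_nhds h1, self_mem_nhdsWithin,
        eventually_nhdsWithin_of_eventually_nhds (Iio_mem_nhds htb)] with s h1 h2 h3
      have h4 : s ≤ b := le_of_lt h3
      simpa [htb.le, h4] using h1 ⟨h2.1, h4⟩
    · have h1 := eventually_nhdsWithin_iff.1 (h.compat t ⟨ht.1, le_rfl⟩)
      have h2 := eventually_nhdsWithin_iff.1 (h'.compat t ⟨le_rfl, ht.2⟩)
      have h3 := (hγ t ht).eventually h'.start.eventually_nhds
      filter_upwards [eventually_nhdsWithin_of_eventually_nhds h1, self_mem_nhdsWithin,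
        eventually_nhdsWithin_of_eventually_nhds h2, h3] with s h1 hs h2 h3
      by_cases hst : s ≤ t
      · simpa [hst] using h1 ⟨hs.1, hst⟩
      · simpa [hst] using (h2 ⟨(not_le.1 hst).le, hs.2⟩).trans h3
    · have h1 := eventually_nhdsWithin_iff.1 (h'.compat t ⟨htb.le, ht.2⟩)
      filter_upwards [eventually_nhdsWithin_of_eventually_nhds h1, self_mem_nhdsWithin,
        eventually_nhdsWithin_of_eventually_nhds (Ioi_mem_nhds htb)] with s h1 h2 h3
      have h4 : b < s := h3
      simpa [htb.not_ge, h4.not_ge] using h1 ⟨h4.le, h2.2⟩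

end IsContinuation

/-- Two composable paths in `S` can be run one after the other; the time of the second one is
shifted. -/
theorem exists_concat {γ Γ : ℝ → ℂ} {a b c d : ℝ} {S : Set ℂ} (hab : a ≤ b) (hcd : c ≤ d)
    (hγ : ContinuousOn γ (Icc a b)) (hΓ : ContinuousOn Γ (Icc c d))
    (hγS : ∀ t ∈ Icc a b, γ t ∈ S) (hΓS : ∀ t ∈ Icc c d, Γ t ∈ S) (h : γ b = Γ c) :
    ∃ P : ℝ → ℂ, ContinuousOn P (Icc a (d + (b - c))) ∧ (∀ t ∈ Icc a (d + (b - c)), P t ∈ S) ∧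
      EqOn γ P (Icc a b) ∧ EqOn (fun t => Γ (t - (b - c))) P (Icc b (d + (b - c))) := by
  have h1 : EqOn γ (fun t => if t ≤ b then γ t else Γ (t - (b - c))) (Icc a b) := fun t ht => by
    simp [ht.2]
  have h2 : EqOn (fun t => Γ (t - (b - c))) (fun t => if t ≤ b then γ t else Γ (t - (b - c)))
      (Icc b (d + (b - c))) := fun t ht => by
    rcases ht.1.eq_or_lt with rfl | hlt
    · simp [h]
    · simp [hlt.not_ge]
  have hu : Icc a (d + (b - c)) = Icc a b ∪ Icc b (d + (b - c)) :=
    (Icc_union_Icc_eq_Icc hab (by linarith)).symm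
  have hm : ∀ t ∈ Icc b (d + (b - c)), t - (b - c) ∈ Icc c d := fun t ht =>
    ⟨by linarith [ht.1], by linarith [ht.2]⟩
  refine ⟨_, ?_, ?_, h1, h2⟩
  · rw [hu]
    refine ContinuousOn.union_of_isClosed (hγ.congr h1.symm) ?_ isClosed_Icc isClosed_Icc
    refine ContinuousOn.congr ?_ h2.symm
    exact hΓ.comp (by fun_prop) hm
  · intro t ht
    rcases hu ▸ ht with ht | ht
    · exact (h1 ht).subst (motive := fun z => z ∈ S) (hγS t ht)
    · exact (h2 ht).subst (motive := fun z => z ∈ S) (hΓS _ (hm t ht))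

/-- `G` is a branch at `ζ` of the Borel transform of `φ`: the germ obtained by continuation along
some path that starts in the disc of radius `ρ` and avoids the lattice. -/
def IsBranch (ω₁ : ℂ) (ρ : ℝ) (φ : PowerSeries ℂ) (G : ℂ → ℂ) (ζ : ℂ) : Prop :=
  ∃ (γ : ℝ → ℂ) (a b : ℝ) (f : ℝ → ℂ → ℂ), a ≤ b ∧ ContinuousOn γ (Icc a b) ∧
    (∀ t ∈ Icc a b, γ t ∉ AddSubgroup.zmultiples ω₁) ∧ γ a ∈ ball (0 : ℂ) ρ ∧
    IsContinuation (borelTransform φ) γ a b f ∧ γ b = ζ ∧ f b =ᶠ[𝓝 ζ] G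

theorem HasSimpleSing.congr {G G' : ℂ → ℂ} {ζ₁ ω a : ℂ} {χ : ℂ → ℂ} (h : HasSimpleSing G ζ₁ ω a χ)
    (hG : G =ᶠ[𝓝 ζ₁] G') : HasSimpleSing G' ζ₁ ω a χ := by
  obtain ⟨hχ, g, F, hg, hgG, h⟩ := h
  exact ⟨hχ, g, F, hg, hgG.trans hG, h⟩

namespace IsBranch

variable {ω₁ : ℂ} {ρ : ℝ} {φ : PowerSeries ℂ} {G G' : ℂ → ℂ} {ζ : ℂ}

theorem congr (h : IsBranch ω₁ ρ φ G ζ) (hG : G =ᶠ[𝓝 ζ] G') : IsBranch ω₁ ρ φ G' ζ := by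
  obtain ⟨γ, a, b, f, hab, hγ, hΩ, h0, hf, hb, hG'⟩ := h
  exact ⟨γ, a, b, f, hab, hγ, hΩ, h0, hf, hb, hG'.trans hG⟩

theorem notMem (h : IsBranch ω₁ ρ φ G ζ) : ζ ∉ AddSubgroup.zmultiples ω₁ := by
  obtain ⟨γ, a, b, f, hab, hγ, hΩ, h0, hf, hb, hG'⟩ := h
  exact hb ▸ hΩ b (right_mem_Icc.2 hab)

theorem analyticAt (h : IsBranch ω₁ ρ φ G ζ) : AnalyticAt ℂ G ζ := by
  obtain ⟨γ, a, b, f, hab, hγ, hΩ, h0, hf, rfl, hG'⟩ := h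
  exact (hf.analytic b (right_mem_Icc.2 hab)).congr hG'

theorem continue_along {Γ : ℝ → ℂ} {c d : ℝ} {f' : ℝ → ℂ → ℂ} (h : IsBranch ω₁ ρ φ G (Γ c))
    (hcd : c ≤ d) (hΓ : ContinuousOn Γ (Icc c d))
    (hΓΩ : ∀ t ∈ Icc c d, Γ t ∉ AddSubgroup.zmultiples ω₁) (hf' : IsContinuation G Γ c d f') :
    IsBranch ω₁ ρ φ (f' d) (Γ d) := by
  obtain ⟨γ, a, b, f, hab, hγ, hΩ, h0, hf, hb, hG⟩ := h
  obtain ⟨P, hP, hPΩ, h1, h2⟩ := exists_concat (S := (AddSubgroup.zmultiples ω₁ : Set ℂ)ᶜ)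
    hab hcd hγ hΓ hΩ hΓΩ hb
  have hbe : b ≤ d + (b - c) := by linarith
  have hPb : P b = Γ c := by rw [← h1 (right_mem_Icc.2 hab), hb]
  have k1 := hf.congr_path hab h1
  have k2 : IsContinuation G P b (d + (b - c)) fun t => f' (t - (b - c)) := by
    have := hf'.shift (b - c)
    rw [show c + (b - c) = b by ring] at this
    exact this.congr_path hbe h2
  have k3 := k1.concat (k2.congr_start (by rw [hPb]; exact hG.symm)) hP hab hbe
  refine ⟨P, a, d + (b - c), _, hab.trans hbe, hP, hPΩ, ?_, k3, ?_, ?_⟩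
  · rwa [← h1 (left_mem_Icc.2 hab)]
  · rw [← h2 (right_mem_Icc.2 hbe)]; simp
  · rcases hcd.eq_or_lt with rfl | hlt
    · simpa using hG.trans hf'.start.symm
    · have : ¬ d + (b - c) ≤ b := by linarith
      simp only [this, if_false]
      rw [show d + (b - c) - (b - c) = d by ring]

/-- The continuation of `φ̂` along the concatenated path agrees with the given one on the first
path, so that it continues the branch `G` on the second one. -/
theorem exists_continuation {Γ : ℝ → ℂ} {c d : ℝ} (hφ : IsSimpleResurgentWith ω₁ φ ρ)
    (h : IsBranch ω₁ ρ φ G (Γ c)) (hcd : c ≤ d) (hΓ : ContinuousOn Γ (Icc c d))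
    (hΓΩ : ∀ t ∈ Icc c d, Γ t ∉ AddSubgroup.zmultiples ω₁) :
    ∃ f', IsContinuation G Γ c d f' := by
  obtain ⟨γ, a, b, f, hab, hγ, hΩ, h0, hf, hb, hG⟩ := h
  obtain ⟨P, hP, hPΩ, h1, h2⟩ := exists_concat (S := (AddSubgroup.zmultiples ω₁ : Set ℂ)ᶜ)
    hab hcd hγ hΓ hΩ hΓΩ hb
  have hbe : b ≤ d + (b - c) := by linarith
  have hPb : P b = Γ c := by rw [← h1 (right_mem_Icc.2 hab), hb]
  obtain ⟨k, hk, -⟩ := hφ.2 P a (d + (b - c)) (hab.trans hbe) hP hPΩ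
    (by rwa [← h1 (left_mem_Icc.2 hab)])
  have e1 := (hk.left hbe).unique_end (hf.congr_path hab h1)
    (hP.mono (Icc_subset_Icc_right hbe)) hab
  have e2 := (((hk.right hab).congr_path hbe h2.symm).congr_start
    (by simpa [hPb] using (hPb ▸ e1).trans hG)).shift (-(b - c))
  refine ⟨fun t => k (t - -(b - c)), ?_⟩
  convert e2 using 1
  · funext t
    congr 1
    ring
  · ring
  · ring

theorem exists_hasSimpleSing (hφ : IsSimpleResurgentWith ω₁ φ ρ) (h : IsBranch ω₁ ρ φ G ζ) {ω : ℂ}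
    (hω : IsNearest ω₁ ζ ω) : ∃ a χ, HasSimpleSing G ζ ω a χ := by
  obtain ⟨γ, a, b, f, hab, hγ, hΩ, h0, hf, rfl, hG⟩ := h
  obtain ⟨k, hk, hs⟩ := hφ.2 γ a b hab hγ hΩ h0
  obtain ⟨a₀, χ, h⟩ := hs ω hω
  exact ⟨a₀, χ, h.congr ((hk.unique_end hf hγ hab).trans hG)⟩

end IsBranch

/-! ### Simple singularities -/

/-- The branch of the logarithm near `exp l` with value `l` at that point. -/
noncomputable def logBranch (l x : ℂ) : ℂ := l + Complex.log (x / Complex.exp l)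

theorem logBranch_exp {l s : ℂ} (h : |(s - l).im| < Real.pi) :
    logBranch l (Complex.exp s) = s := by
  rw [logBranch, ← Complex.exp_sub, Complex.log_exp (neg_lt_of_abs_lt h) (lt_of_abs_lt h).le]
  ring

theorem hasDerivAt_logBranch {l x : ℂ} (h : x / Complex.exp l ∈ Complex.slitPlane) :
    HasDerivAt (logBranch l) x⁻¹ x := by
  refine ((((hasDerivAt_id x).div_const (Complex.exp l)).clog h).const_add l).congr_deriv ?_
  have : Complex.exp l ≠ 0 := Complex.exp_ne_zero l
  have hx : x ≠ 0 := by rintro rfl; simp [Complex.mem_slitPlane_iff] at h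
  simp only [id]
  field_simp

theorem div_mem_slitPlane {ζ₁ ω ξ : ℂ} (h : ω + ξ ∈ ball ζ₁ (dist ζ₁ ω)) :
    ξ / (ζ₁ - ω) ∈ Complex.slitPlane := by
  have h0 : ζ₁ - ω ≠ 0 := by
    intro h0
    rw [sub_eq_zero.1 h0] at h
    simp at h
  have : ‖(ω + ξ - ζ₁) / (ζ₁ - ω)‖ < 1 := by
    rw [norm_div, div_lt_one (norm_pos_iff.2 h0)]
    simpa [dist_eq_norm] using h
  have h2 := Complex.mem_slitPlane_of_norm_lt_one this
  convert h2 using 1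
  field_simp
  ring

theorem eventually_zero_of_mul_self {f : ℂ → ℂ} (hf : AnalyticAt ℂ f 0)
    (h : ∀ᶠ ξ in 𝓝 (0 : ℂ), ξ * f ξ = 0) : ∀ᶠ ξ in 𝓝 (0 : ℂ), f ξ = 0 := by
  refine hf.frequently_zero_iff_eventually_zero.1 (Eventually.frequently ?_)
  filter_upwards [eventually_nhdsWithin_of_eventually_nhds h, self_mem_nhdsWithin] with ξ h1 h2
  exact (mul_eq_zero.1 h1).resolve_left h2

/-- The logarithm is transcendental over the field of meromorphic germs: if `A + B log` vanishes on
a disc that touches `0`, then `A` and `B` vanish. With `ξ = exp s` the relation extends to a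
half-plane, where the shift by `2πi` isolates `B`. -/
theorem eventually_zero_of_add_mul_log {ζ₁ ω : ℂ} (hne : ζ₁ ≠ ω) {A B : ℂ → ℂ}
    (hA : AnalyticAt ℂ A 0) (hB : AnalyticAt ℂ B 0)
    (h : ∀ᶠ ξ in 𝓝 (0 : ℂ), ω + ξ ∈ ball ζ₁ (dist ζ₁ ω) →
      A ξ + B ξ * (Complex.log (ξ / (ζ₁ - ω)) + Complex.log (ζ₁ - ω)) = 0) :
    (∀ᶠ ξ in 𝓝 (0 : ℂ), A ξ = 0) ∧ ∀ᶠ ξ in 𝓝 (0 : ℂ), B ξ = 0 := by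
  obtain ⟨r₁, hr₁, hA⟩ := hA.exists_ball_analyticOnNhd
  obtain ⟨r₂, hr₂, hB⟩ := hB.exists_ball_analyticOnNhd
  obtain ⟨r₃, hr₃, h⟩ := eventually_nhds_iff_ball.1 h
  obtain ⟨r, hr, hr1, hr2, hr3⟩ : ∃ r > 0, r ≤ r₁ ∧ r ≤ r₂ ∧ r ≤ r₃ :=
    ⟨min r₁ (min r₂ r₃), by positivity, by simp, by simp, by simp⟩
  have hu : ζ₁ - ω ≠ 0 := sub_ne_zero.2 hne
  set l := Complex.log (ζ₁ - ω)
  have hl : Complex.exp l = ζ₁ - ω := Complex.exp_log hu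
  let H : Set ℂ := {s | s.re < Real.log r}
  have hexp : ∀ s ∈ H, Complex.exp s ∈ ball (0 : ℂ) r := fun s hs => by
    rw [mem_ball_zero_iff, Complex.norm_exp]
    exact (Real.lt_log_iff_exp_lt hr).1 hs
  have hHo : IsOpen H := isOpen_lt Complex.continuous_re continuous_const
  have hHc : IsPreconnected H := (convex_halfSpace_re_lt _).isPreconnected
  have hh : AnalyticOnNhd ℂ (fun s => A (Complex.exp s) + B (Complex.exp s) * s) H := by
    intro s hs
    have e : AnalyticAt ℂ Complex.exp s := analyticAt_cexp
    exact ((hA _ (ball_subset_ball hr1 (hexp s hs))).comp e).add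
      (((hB _ (ball_subset_ball hr2 (hexp s hs))).comp e).mul analyticAt_id)
  obtain ⟨M, hM0, hM⟩ : ∃ M : ℝ, 0 < M ∧ l.re - M < Real.log r :=
    ⟨max 1 (l.re - Real.log r + 1), by positivity, by
      have := le_max_right 1 (l.re - Real.log r + 1); linarith⟩
  have hs0 : l - M ∈ H := by simpa [H] using hM
  have hball : ω + Complex.exp (l - M) ∈ ball ζ₁ (dist ζ₁ ω) := by
    rw [mem_ball, dist_eq_norm, dist_eq_norm, Complex.exp_sub, hl,
      show ω + (ζ₁ - ω) / Complex.exp M - ζ₁ = -(1 - Complex.exp (-M)) * (ζ₁ - ω) by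
        rw [Complex.exp_neg]; field_simp; ring, norm_mul, norm_neg]
    have : (1 : ℂ) - Complex.exp (-M) = ((1 - Real.exp (-M) : ℝ) : ℂ) := by push_cast; rfl
    rw [this, Complex.norm_real, Real.norm_eq_abs]
    have h1 : Real.exp (-M) < 1 := by simpa using hM0
    have h2 := Real.exp_pos (-M)
    rw [abs_of_pos (by linarith)]
    nlinarith [norm_pos_iff.2 hu]
  have hz : (fun s => A (Complex.exp s) + B (Complex.exp s) * s) =ᶠ[𝓝 (l - M)] 0 := by
    have e1 : ∀ᶠ s in 𝓝 (l - (M : ℂ)), ω + Complex.exp s ∈ ball ζ₁ (dist ζ₁ ω) :=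
      (by fun_prop : ContinuousAt (fun s => ω + Complex.exp s) (l - M)).eventually
        (isOpen_ball.mem_nhds hball)
    have e2 : ∀ᶠ s in 𝓝 (l - (M : ℂ)), |(s - l).im| < Real.pi := by
      have hc : ContinuousAt (fun s : ℂ => |(s - l).im|) (l - M) := by fun_prop
      refine hc.eventually (Iio_mem_nhds ?_)
      simpa using Real.pi_pos
    filter_upwards [e1, e2, hHo.mem_nhds hs0] with s h1 h2 h3
    have h4 := h _ (ball_subset_ball hr3 (hexp s h3)) h1
    have h5 := logBranch_exp h2
    rw [logBranch, hl, add_comm] at h5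
    rwa [h5] at h4
  have hzero := hh.eqOn_zero_of_preconnected_of_eventuallyEq_zero hHc hs0 hz
  have hAB : ∀ ξ ∈ ball (0 : ℂ) r, ξ ≠ 0 → A ξ = 0 ∧ B ξ = 0 := by
    intro ξ hξ hξ0
    have hs : Complex.log ξ ∈ H := by
      simp only [H, mem_ofPred_eq, Complex.log_re]
      exact Real.log_lt_log (norm_pos_iff.2 hξ0) (mem_ball_zero_iff.1 hξ)
    have hs' : Complex.log ξ + 2 * Real.pi * Complex.I ∈ H := by
      simpa [H] using hs
    have h1 := hzero hs
    have h2 := hzero hs'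
    simp only [Complex.exp_periodic _, Complex.exp_log hξ0, Pi.zero_apply] at h1 h2
    have h3 : B ξ = 0 := by
      have : B ξ * (2 * Real.pi * Complex.I) = 0 := by linear_combination h2 - h1
      exact (mul_eq_zero.1 this).resolve_right Complex.two_pi_I_ne_zero
    exact ⟨by simpa [h3] using h1, h3⟩
  have hev : ∀ᶠ ξ in 𝓝[≠] (0 : ℂ), A ξ = 0 ∧ B ξ = 0 := by
    filter_upwards [eventually_nhdsWithin_of_eventually_nhds (ball_mem_nhds (0 : ℂ) hr),
      self_mem_nhdsWithin] with ξ h1 h2 using hAB ξ h1 h2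
  exact ⟨(hA 0 (mem_ball_self hr₁)).frequently_zero_iff_eventually_zero.1
      (hev.mono fun _ h => h.1).frequently,
    (hB 0 (mem_ball_self hr₂)).frequently_zero_iff_eventually_zero.1
      (hev.mono fun _ h => h.2).frequently⟩

theorem ne_zero_of_add_mem_ball {ζ₁ ω ξ : ℂ} (h : ω + ξ ∈ ball ζ₁ (dist ζ₁ ω)) : ξ ≠ 0 := by
  rintro rfl
  simp [dist_comm] at h

theorem HasSimpleSing.unique {G : ℂ → ℂ} {ζ₁ ω a a' : ℂ} {χ χ' : ℂ → ℂ} (hne : ζ₁ ≠ ω)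
    (h : HasSimpleSing G ζ₁ ω a χ) (h' : HasSimpleSing G ζ₁ ω a' χ') :
    a = a' ∧ χ =ᶠ[𝓝 0] χ' := by
  obtain ⟨hχ, g, F, hg, hgG, hF, h⟩ := h
  obtain ⟨hχ', g', F', hg', hgG', hF', h'⟩ := h'
  have hd : 0 < dist ζ₁ ω := dist_pos.2 hne
  have hgg : EqOn g g' (ball ζ₁ (dist ζ₁ ω)) :=
    (hg.analyticOnNhd isOpen_ball).eqOn_of_preconnected_of_eventuallyEq
      (hg'.analyticOnNhd isOpen_ball) (convex_ball _ _).isPreconnected (mem_ball_self hd)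
      (hgG.trans hgG'.symm)
  have key := eventually_zero_of_add_mul_log hne
    (A := fun ξ => (a - a') + 2 * Real.pi * Complex.I * (ξ * (F ξ - F' ξ)))
    (B := fun ξ => ξ * (χ ξ - χ' ξ)) (by fun_prop) (by fun_prop) (by
      filter_upwards [h, h'] with ξ h1 h2 hξ
      have h3 := (h1 hξ).symm.trans ((hgg hξ).trans (h2 hξ))
      have hξ0 := ne_zero_of_add_mem_ball hξ
      have := Real.pi_ne_zero
      field_simp at h3
      linear_combination h3)
  have h0 := key.1.self_of_nhds
  simp only [zero_mul, mul_zero, add_zero] at h0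
  refine ⟨sub_eq_zero.1 h0, ?_⟩
  filter_upwards [eventually_zero_of_mul_self (hχ.sub hχ') key.2] with ξ hξ
  exact sub_eq_zero.1 hξ

theorem exists_primitive {f : ℂ → ℂ} {z : ℂ} (hf : AnalyticAt ℂ f z) (y : ℂ) :
    ∃ X, AnalyticAt ℂ X z ∧ X z = y ∧ ∀ᶠ w in 𝓝 z, HasDerivAt X (f w) w := by
  obtain ⟨r, hr, h⟩ := hf.exists_ball_analyticOnNhd
  obtain ⟨X, h1, h2⟩ := (h.differentiableOn.isExactOn_ball).with_val_at z y
  have h3 : ∀ᶠ w in 𝓝 z, HasDerivAt X (f w) w := by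
    filter_upwards [ball_mem_nhds z hr] with w hw using h2 w hw
  exact ⟨X, Complex.analyticAt_iff_eventually_differentiableAt.2
    (h3.mono fun w hw => hw.differentiableAt), h1, h3⟩

theorem exists_const_of_hasDerivAt {f g h : ℂ → ℂ} {U : Set ℂ} (hU : IsOpen U)
    (hc : IsPreconnected U) (hf : ∀ z ∈ U, HasDerivAt f (h z) z)
    (hg : ∀ z ∈ U, HasDerivAt g (h z) z) : ∃ c, ∀ z ∈ U, f z = g z + c := by
  obtain ⟨c, hc⟩ := hU.exists_is_const_of_deriv_eq_zero hc (f := f - g)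
    (fun z hz => ((hf z hz).sub (hg z hz)).differentiableAt.differentiableWithinAt)
    (fun z hz => by simpa using ((hf z hz).sub (hg z hz)).deriv)
  exact ⟨c, fun z hz => by rw [← hc z hz]; simp⟩

theorem eventuallyEq_of_hasDerivAt {f g h : ℂ → ℂ} {z : ℂ}
    (hf : ∀ᶠ w in 𝓝 z, HasDerivAt f (h w) w) (hg : ∀ᶠ w in 𝓝 z, HasDerivAt g (h w) w)
    (hz : f z = g z) : f =ᶠ[𝓝 z] g := by
  obtain ⟨r, hr, H⟩ := eventually_nhds_iff_ball.1 (hf.and hg)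
  obtain ⟨c, hc⟩ := exists_const_of_hasDerivAt isOpen_ball (convex_ball _ _).isPreconnected
    (fun w hw => (H w hw).1) (fun w hw => (H w hw).2)
  have h0 := hc z (mem_ball_self hr)
  have hc0 : c = 0 := by rw [hz] at h0; simpa using h0
  filter_upwards [ball_mem_nhds z hr] with w hw
  simpa [hc0] using hc w hw

theorem exists_analyticAt_mul_self_add {X : ℂ → ℂ} (hX : AnalyticAt ℂ X 0) :
    ∃ Q, AnalyticAt ℂ Q 0 ∧ ∀ ξ, X ξ = X 0 + ξ * Q ξ := by
  obtain ⟨p, hp⟩ := hX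
  refine ⟨dslope X 0, ⟨_, hp.has_fpower_series_dslope_fslope⟩, fun ξ => ?_⟩
  have := sub_smul_dslope X 0 ξ
  simp only [sub_zero, smul_eq_mul] at this
  rw [this]
  ring

/-- Integration turns the singular data `(a, χ)` into `(0, X)`, where `X` is the primitive of `χ`
with `X(0) = a`. -/
theorem HasSimpleSing.primitive {G P : ℂ → ℂ} {ζ₁ ω a : ℂ} {χ : ℂ → ℂ} (hne : ζ₁ ≠ ω)
    (h : HasSimpleSing G ζ₁ ω a χ) (hP : ∀ᶠ z in 𝓝 ζ₁, HasDerivAt P (G z) z) :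
    ∃ X, AnalyticAt ℂ X 0 ∧ X 0 = a ∧ (∀ᶠ ξ in 𝓝 (0 : ℂ), HasDerivAt X (χ ξ) ξ) ∧
      HasSimpleSing P ζ₁ ω 0 X := by
  obtain ⟨hχ, g, F, hg, hgG, hF, h⟩ := h
  have hd : 0 < dist ζ₁ ω := dist_pos.2 hne
  obtain ⟨X, hX, hX0, hXd⟩ := exists_primitive hχ a
  obtain ⟨Q, hQ, hXQ⟩ := exists_analyticAt_mul_self_add hX
  obtain ⟨Y, hY, -, hYd⟩ := exists_primitive
    (hF.sub (hQ.div_const (c := 2 * Real.pi * Complex.I))) 0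
  obtain ⟨p, hp1, hp2⟩ := hg.isExactOn_ball.with_val_at ζ₁ (P ζ₁)
  obtain ⟨r, hr, H⟩ := eventually_nhds_iff_ball.1 (h.and (hXd.and hYd))
  set L : ℂ → ℂ := fun ξ => Complex.log (ξ / (ζ₁ - ω)) + Complex.log (ζ₁ - ω)
  have hL : ∀ ξ, ω + ξ ∈ ball ζ₁ (dist ζ₁ ω) → HasDerivAt L ξ⁻¹ ξ := fun ξ hξ => by
    have hu : Complex.exp (Complex.log (ζ₁ - ω)) = ζ₁ - ω := Complex.exp_log (sub_ne_zero.2 hne)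
    have := hasDerivAt_logBranch (l := Complex.log (ζ₁ - ω)) (x := ξ)
      (by rw [hu]; exact div_mem_slitPlane hξ)
    convert this using 1
    funext x
    simp only [L, logBranch, hu]
    ring
  have hUe : ∀ ξ, ξ ∈ ball (ζ₁ - ω) (dist ζ₁ ω) ↔ ω + ξ ∈ ball ζ₁ (dist ζ₁ ω) := fun ξ => by
    simp only [mem_ball, dist_eq_norm]
    rw [show ξ - (ζ₁ - ω) = ω + ξ - ζ₁ by ring]
  obtain ⟨c, hc⟩ := exists_const_of_hasDerivAt (f := fun ξ => p (ω + ξ))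
    (g := fun ξ => X ξ * L ξ / (2 * Real.pi * Complex.I) + Y ξ) (h := fun ξ => g (ω + ξ))
    (U := ball 0 r ∩ ball (ζ₁ - ω) (dist ζ₁ ω)) (isOpen_ball.inter isOpen_ball)
    ((convex_ball _ _).inter (convex_ball _ _)).isPreconnected
    (fun ξ hξ => (hp2 _ ((hUe ξ).1 hξ.2)).comp_const_add ω ξ)
    (fun ξ hξ => by
      have hξ2 := (hUe ξ).1 hξ.2
      obtain ⟨h1, h2, h3⟩ := H ξ hξ.1
      refine (((h2.mul (hL ξ hξ2)).div_const (2 * Real.pi * Complex.I)).add h3).congr_deriv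
        (Eq.symm ?_)
      have hξ0 := ne_zero_of_add_mem_ball hξ2
      have := Real.pi_ne_zero
      rw [h1 hξ2, hXQ ξ, hX0]
      simp only [L, Pi.sub_apply]
      field_simp
      ring)
  refine ⟨X, hX, hX0, hXd, hX, p, fun ξ => Y ξ + c,
    fun z hz => (hp2 z hz).differentiableAt.differentiableWithinAt, ?_, by fun_prop, ?_⟩
  · refine eventuallyEq_of_hasDerivAt (h := g) ?_ ?_ hp1
    · filter_upwards [ball_mem_nhds ζ₁ hd] with z hz using hp2 z hz
    · filter_upwards [hP, hgG] with z h1 h2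
      rwa [h2]
  · filter_upwards [ball_mem_nhds 0 hr] with ξ hξ hξ2
    rw [hc ξ ⟨hξ, (hUe ξ).2 hξ2⟩]
    simp only [L]
    ring

/-- Division by `ζ - c` of a function with singular data `(0, X)`. At `ω = c` the result has a
simple singularity because `X(0) = 0`. -/
theorem HasSimpleSing.div_sub {P : ℂ → ℂ} {ζ₁ ω c : ℂ} {X : ℂ → ℂ}
    (h : HasSimpleSing P ζ₁ ω 0 X) (hc : c ∉ ball ζ₁ (dist ζ₁ ω)) (hX0 : ω = c → X 0 = 0) :
    ∃ a χ, HasSimpleSing (fun z => P z / (z - c)) ζ₁ ω a χ ∧ (ω - c) * a = 0 ∧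
      ∀ᶠ ξ in 𝓝 (0 : ℂ), (ξ + (ω - c)) * χ ξ = X ξ := by
  obtain ⟨hX, g, F, hg, hgP, hF, h⟩ := h
  have hgd : DifferentiableOn ℂ (fun z => g z / (z - c)) (ball ζ₁ (dist ζ₁ ω)) :=
    hg.div (by fun_prop) fun z hz => sub_ne_zero.2 fun hzc => hc (hzc ▸ hz)
  have hge : (fun z => g z / (z - c)) =ᶠ[𝓝 ζ₁] fun z => P z / (z - c) := by
    filter_upwards [hgP] with z hz
    rw [hz]
  by_cases hω : ω = c
  · subst hω
    obtain ⟨Q, hQ, hXQ⟩ := exists_analyticAt_mul_self_add hX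
    obtain ⟨E, hE, hFE⟩ := exists_analyticAt_mul_self_add hF
    refine ⟨2 * Real.pi * Complex.I * F 0, Q, ⟨hQ, _, E, hgd, hge, hE, ?_⟩, by simp,
      Eventually.of_forall fun ξ => ?_⟩
    · filter_upwards [h] with ξ h1 hξ
      have hξ0 := ne_zero_of_add_mem_ball hξ
      have := Real.pi_ne_zero
      rw [h1 hξ, hXQ, hFE ξ, hX0 rfl, add_sub_cancel_left]
      field_simp
      ring
    · rw [hXQ ξ, hX0 rfl]
      ring
  · have hq : ω - c ≠ 0 := sub_ne_zero.2 hω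
    have hne : ∀ᶠ ξ in 𝓝 (0 : ℂ), ξ + (ω - c) ≠ 0 :=
      (by fun_prop : ContinuousAt (fun ξ => ξ + (ω - c)) 0).eventually_ne (by simpa using hq)
    refine ⟨0, fun ξ => X ξ / (ξ + (ω - c)),
      ⟨?_, _, fun ξ => F ξ / (ξ + (ω - c)), hgd, hge, ?_, ?_⟩, by simp, ?_⟩
    · exact hX.div (by fun_prop) (by simpa using hq)
    · exact hF.div (by fun_prop) (by simpa using hq)
    · filter_upwards [h, hne] with ξ h1 h2 hξ
      rw [h1 hξ, show ω + ξ - c = ξ + (ω - c) by ring]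
      have := Real.pi_ne_zero
      field_simp
      ring
    · filter_upwards [hne] with ξ h2
      field_simp

/-! ### The lattice and the Borel transform -/

theorem norm_le_of_mem_zmultiples {ω₁ ω : ℂ} (h : ω ∈ AddSubgroup.zmultiples ω₁) (h0 : ω ≠ 0) :
    ‖ω₁‖ ≤ ‖ω‖ := by
  obtain ⟨n, rfl⟩ := AddSubgroup.mem_zmultiples_iff.1 h
  have hn : n ≠ 0 := by rintro rfl; simp at h0
  rw [zsmul_eq_mul, norm_mul, Complex.norm_intCast]
  have : (1 : ℝ) ≤ |(n : ℝ)| := by exact_mod_cast Int.one_le_abs hn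
  nlinarith [norm_nonneg ω₁]

theorem notMem_zmultiples {ω₁ ζ : ℂ} (h0 : ζ ≠ 0) (h : ‖ζ‖ < ‖ω₁‖) :
    ζ ∉ AddSubgroup.zmultiples ω₁ := fun hm => (norm_le_of_mem_zmultiples hm h0).not_gt h

theorem isNearest_zero {ω₁ ζ : ℂ} (h : ‖ζ‖ ≤ ‖ω₁‖ / 2) : IsNearest ω₁ ζ 0 := by
  refine ⟨zero_mem _, fun ω hω => ?_⟩
  rcases eq_or_ne ω 0 with rfl | h0
  · rfl
  · have h1 := norm_le_of_mem_zmultiples hω h0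
    have h2 : ‖ω‖ ≤ ‖ζ‖ + dist ζ ω := by
      rw [dist_comm, dist_eq_norm]
      simpa using norm_add_le ζ (ω - ζ)
    rw [dist_zero_right]
    linarith

theorem IsNearest.notMem_ball {ω₁ ζ ω c : ℂ} (h : IsNearest ω₁ ζ ω)
    (hc : c ∈ AddSubgroup.zmultiples ω₁) : c ∉ ball ζ (dist ζ ω) := fun hm => by
  rw [mem_ball, dist_comm] at hm
  exact (h.2 c hc).not_gt hm

theorem IsNearest.ne {ω₁ ζ ω : ℂ} (h : IsNearest ω₁ ζ ω) (hζ : ζ ∉ AddSubgroup.zmultiples ω₁) :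
    ζ ≠ ω := fun e => hζ (e ▸ h.1)

theorem IsNearest.translate {ω₁ ζ ω' ω : ℂ} (h : IsNearest ω₁ ζ ω')
    (hω : ω ∈ AddSubgroup.zmultiples ω₁) : IsNearest ω₁ (ω + ζ) (ω + ω') := by
  refine ⟨add_mem hω h.1, fun c hc => ?_⟩
  rw [dist_add_left]
  convert h.2 (c - ω) (sub_mem hc hω) using 1
  rw [dist_eq_norm, dist_eq_norm]
  congr 1
  ring

theorem hasFPowerSeriesOnBall_borelTransform {φ : PowerSeries ℂ} {ρ : ℝ} (hρ : 0 < ρ)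
    (h : ∀ ζ ∈ ball (0 : ℂ) ρ, Summable (borelTerm φ ζ)) :
    HasFPowerSeriesOnBall (borelTransform φ) (FormalMultilinearSeries.ofScalars ℂ
      (fun n => PowerSeries.coeff (n + 1) φ / (n.factorial : ℂ))) 0 (ENNReal.ofReal ρ) := by
  refine ⟨ENNReal.le_of_forall_nnreal_lt fun r hr => ?_, by simpa using hρ, fun {y} hy => ?_⟩
  · have hr' : (r : ℝ) < ρ := by
      simpa using (ENNReal.lt_ofReal_iff_toReal_lt (by simp)).1 hr
    have hs := (h (r : ℝ) (by simpa using hr')).tendsto_atTop_zero.norm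
    refine FormalMultilinearSeries.le_radius_of_tendsto _ (l := 0) ?_
    simp only [norm_zero] at hs
    convert hs using 2 with n
    rw [FormalMultilinearSeries.ofScalars_norm, borelTerm]
    simp
    ring
  · rw [zero_add]
    have hy' : y ∈ ball (0 : ℂ) ρ := by
      simpa [Metric.eball_ofReal] using hy
    refine HasSum.congr_fun (h y hy').hasSum fun n => ?_
    rw [FormalMultilinearSeries.ofScalars_apply_eq, borelTerm]
    simp
    ring

theorem differentiableOn_borelTransform {φ : PowerSeries ℂ} {ρ : ℝ}
    (h : ∀ ζ ∈ ball (0 : ℂ) ρ, Summable (borelTerm φ ζ)) :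
    DifferentiableOn ℂ (borelTransform φ) (ball 0 ρ) := by
  rcases le_or_gt ρ 0 with hρ | hρ
  · rw [ball_eq_empty.2 hρ]; exact differentiableOn_empty
  · have := (hasFPowerSeriesOnBall_borelTransform hρ h).differentiableOn
    rwa [Metric.eball_ofReal] at this

theorem iteratedDeriv_borelTransform {φ : PowerSeries ℂ} {ρ : ℝ} (hρ : 0 < ρ)
    (h : ∀ ζ ∈ ball (0 : ℂ) ρ, Summable (borelTerm φ ζ)) (n : ℕ) :
    iteratedDeriv n (borelTransform φ) 0 = PowerSeries.coeff (n + 1) φ := by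
  have h1 := (hasFPowerSeriesOnBall_borelTransform hρ h).hasFPowerSeriesAt
  have h2 := h1.analyticAt.hasFPowerSeriesAt
  have h3 := congrArg (fun p => FormalMultilinearSeries.coeff p n)
    (h1.eq_formalMultilinearSeries h2)
  simp only [FormalMultilinearSeries.coeff_ofScalars] at h3
  have : (n.factorial : ℂ) ≠ 0 := by exact_mod_cast n.factorial_ne_zero
  field_simp at h3
  exact h3.symm

theorem hasSum_borelTerm {φ : PowerSeries ℂ} {χ : ℂ → ℂ} {ρ : ℝ}
    (hχ : DifferentiableOn ℂ χ (ball 0 ρ))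
    (h : ∀ n, PowerSeries.coeff (n + 1) φ = iteratedDeriv n χ 0) {ζ : ℂ} (hζ : ζ ∈ ball (0 : ℂ) ρ) :
    HasSum (borelTerm φ ζ) (χ ζ) := by
  refine HasSum.congr_fun (Complex.hasSum_taylorSeries_on_ball hχ hζ) fun n => ?_
  rw [borelTerm, h]
  simp
  ring

theorem coeff_succ_invBorel (a : ℂ) (χ : ℂ → ℂ) (n : ℕ) :
    PowerSeries.coeff (n + 1) (invBorel a χ) = iteratedDeriv n χ 0 := by
  simp [invBorel]

theorem coeff_zero_invBorel (a : ℂ) (χ : ℂ → ℂ) :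
    PowerSeries.coeff 0 (invBorel a χ) = a := by
  rw [invBorel, PowerSeries.coeff_mk]
  rfl

/-! ### The disc of convergence of the Borel transform -/

section Extension

variable {ω₁ : ℂ} {φ : PowerSeries ℂ} {ρ : ℝ}

theorem real_mul_mem_ball {u : ℂ} (hu : ‖u‖ = 1) {R t : ℝ} (h0 : 0 < t) (h1 : t < 2 * R) :
    (t : ℂ) * u ∈ ball ((R : ℂ) * u) R := by
  rw [mem_ball, dist_eq_norm, ← sub_mul, norm_mul, hu, mul_one, ← Complex.ofReal_sub,
    Complex.norm_real, Real.norm_eq_abs, abs_lt]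
  constructor <;> linarith

/-- The simple singularity that the branch reached along a radius has at the nearest point `0`
extends the Borel transform to a disc with `0` on its boundary. -/
theorem IsSimpleResurgentWith.exists_extension_disc (hω₁ : ω₁ ≠ 0) (hρ : 0 < ρ)
    (hφ : IsSimpleResurgentWith ω₁ φ ρ) {u : ℂ} (hu : ‖u‖ = 1) :
    ∃ g, DifferentiableOn ℂ g (ball ((‖ω₁‖ / 2 : ℝ) * u) (‖ω₁‖ / 2)) ∧
      ∀ ζ ∈ ball (((‖ω₁‖ / 2 : ℝ) : ℂ) * u) (‖ω₁‖ / 2) ∩ ball 0 ρ, g ζ = borelTransform φ ζ := by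
  have hR : 0 < ‖ω₁‖ / 2 := by positivity
  have hRω : ‖ω₁‖ / 2 < ‖ω₁‖ := by linarith
  set R := ‖ω₁‖ / 2
  obtain ⟨s, hs0, hsρ, hsR⟩ : ∃ s : ℝ, 0 < s ∧ s < ρ ∧ s ≤ R :=
    ⟨min (ρ / 2) R, by positivity, (min_le_left _ _).trans_lt (by linarith), min_le_right _ _⟩
  have hnorm : ∀ t : ℝ, 0 < t → ‖(t : ℂ) * u‖ = t := fun t ht => by
    rw [norm_mul, hu, mul_one, Complex.norm_real, Real.norm_of_nonneg ht.le]
  have hγ : ContinuousOn (fun t : ℝ => (t : ℂ) * u) (Icc s R) := by fun_prop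
  have hmem : ∀ t ∈ Icc s R, (t : ℂ) * u ∈ ball ((R : ℂ) * u) R := fun t ht =>
    real_mul_mem_ball hu (hs0.trans_le ht.1) (by linarith [ht.2])
  have hs : ((s : ℝ) : ℂ) * u ∈ ball (0 : ℂ) ρ := by rw [mem_ball_zero_iff, hnorm s hs0]; exact hsρ
  obtain ⟨f, hf, hsing⟩ := hφ.2 (fun t : ℝ => (t : ℂ) * u) s R hsR hγ (fun t ht => by
    have ht0 : 0 < t := hs0.trans_le ht.1
    refine notMem_zmultiples (norm_pos_iff.1 ?_) ?_
    · rwa [hnorm t ht0]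
    · rw [hnorm t ht0]; exact ht.2.trans_lt hRω) hs
  obtain ⟨a, χ, -, g, F, hg, hgf, -⟩ := hsing 0 (isNearest_zero (hnorm R hR).le)
  rw [dist_zero_right, hnorm R hR] at hg
  refine ⟨g, hg, fun ζ hζ => ?_⟩
  have hga := hg.analyticOnNhd isOpen_ball
  have hcont : IsContinuation g (fun t : ℝ => (t : ℂ) * u) s R fun _ => g :=
    IsContinuation.const fun t ht => hga _ (hmem t ht)
  have e1 := (hf.unique hcont hγ (right_mem_Icc.2 hsR) (left_mem_Icc.2 hsR) hgf.symm)
  exact (hga.mono inter_subset_left).eqOn_of_preconnected_of_eventuallyEq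
    (((differentiableOn_borelTransform hφ.1).analyticOnNhd isOpen_ball).mono inter_subset_right)
    ((convex_ball _ _).inter (convex_ball _ _)).isPreconnected ⟨hmem s (left_mem_Icc.2 hsR), hs⟩
    (e1.symm.trans hf.start) hζ

theorem real_mul_mem_ball_of_mem {v ζ : ℂ} {R s : ℝ} (hv : ‖v‖ = R) (hs0 : 0 < s) (hs1 : s ≤ 1)
    (hζ : ζ ∈ ball v R) : (s : ℂ) * ζ ∈ ball v R := by
  rw [mem_ball, dist_eq_norm] at *
  calc ‖(s : ℂ) * ζ - v‖ = ‖(s : ℂ) * (ζ - v) - ((1 - s : ℝ) : ℂ) * v‖ := by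
        congr 1; push_cast; ring
    _ ≤ ‖(s : ℂ) * (ζ - v)‖ + ‖((1 - s : ℝ) : ℂ) * v‖ := norm_sub_le _ _
    _ = s * ‖ζ - v‖ + (1 - s) * R := by
        rw [norm_mul, norm_mul, hv, Complex.norm_real, Complex.norm_real,
          Real.norm_of_nonneg hs0.le, Real.norm_of_nonneg (by linarith)]
    _ < R := by nlinarith

/-- The Borel transform of a simple resurgent series extends to the disc of radius `|ω₁|`: the discs
with `0` on their boundary overlap in convex sets that accumulate at `0`. -/
theorem IsSimpleResurgentWith.exists_extension (hω₁ : ω₁ ≠ 0) (hρ : 0 < ρ)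
    (hφ : IsSimpleResurgentWith ω₁ φ ρ) :
    ∃ g, DifferentiableOn ℂ g (ball 0 ‖ω₁‖) ∧ g =ᶠ[𝓝 0] borelTransform φ := by
  have hR : 0 < ‖ω₁‖ / 2 := by positivity
  set R := ‖ω₁‖ / 2 with hRdef
  have hdisc : ∀ u : ℂ, ∃ g, ‖u‖ = 1 → DifferentiableOn ℂ g (ball ((R : ℂ) * u) R) ∧
      ∀ ζ ∈ ball ((R : ℂ) * u) R ∩ ball 0 ρ, g ζ = borelTransform φ ζ := fun u => by
    by_cases hu : ‖u‖ = 1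
    · obtain ⟨g, hg⟩ := hφ.exists_extension_disc hω₁ hρ hu
      exact ⟨g, fun _ => hg⟩
    · exact ⟨0, fun h => absurd h hu⟩
  choose g hg using hdisc
  have hRu : ∀ u : ℂ, ‖u‖ = 1 → ‖(R : ℂ) * u‖ = R := fun u hu => by
    rw [norm_mul, hu, mul_one, Complex.norm_real, Real.norm_of_nonneg hR.le]
  have overlap : ∀ u v : ℂ, ‖u‖ = 1 → ‖v‖ = 1 → ∀ ζ ∈ ball ((R : ℂ) * u) R ∩ ball ((R : ℂ) * v) R,
      g u ζ = g v ζ := by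
    intro u v hu hv ζ hζ
    obtain ⟨s, hs0, hs1, hs⟩ : ∃ s : ℝ, 0 < s ∧ s ≤ 1 ∧ (s : ℂ) * ζ ∈ ball (0 : ℂ) ρ := by
      refine ⟨min 1 (ρ / (‖ζ‖ + 1)), by positivity, min_le_left _ _, ?_⟩
      rw [mem_ball_zero_iff, norm_mul, Complex.norm_real, Real.norm_of_nonneg (by positivity)]
      calc min 1 (ρ / (‖ζ‖ + 1)) * ‖ζ‖ ≤ ρ / (‖ζ‖ + 1) * ‖ζ‖ := by
            gcongr; exact min_le_right _ _
        _ < ρ := by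
            rw [div_mul_eq_mul_div, div_lt_iff₀ (by positivity)]
            nlinarith
    have hm : (s : ℂ) * ζ ∈ ball ((R : ℂ) * u) R ∩ ball ((R : ℂ) * v) R :=
      ⟨real_mul_mem_ball_of_mem (hRu u hu) hs0 hs1 hζ.1,
        real_mul_mem_ball_of_mem (hRu v hv) hs0 hs1 hζ.2⟩
    refine ((((hg u hu).1.analyticOnNhd isOpen_ball).mono
      inter_subset_left).eqOn_of_preconnected_of_eventuallyEq
      (((hg v hv).1.analyticOnNhd isOpen_ball).mono inter_subset_right)
      ((convex_ball _ _).inter (convex_ball _ _)).isPreconnected hm ?_) hζ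
    filter_upwards [isOpen_ball.mem_nhds hs, isOpen_ball.mem_nhds hm.1,
      isOpen_ball.mem_nhds hm.2] with z h1 h2 h3
    rw [(hg u hu).2 z ⟨h2, h1⟩, (hg v hv).2 z ⟨h3, h1⟩]
  have hunit : ∀ ζ : ℂ, ζ ≠ 0 → ‖ζ / (‖ζ‖ : ℂ)‖ = 1 := fun ζ hζ => by
    rw [norm_div, Complex.norm_real, norm_norm, div_self (norm_ne_zero_iff.2 hζ)]
  have hself : ∀ ζ : ℂ, ζ ≠ 0 → ‖ζ‖ < ‖ω₁‖ → ζ ∈ ball ((R : ℂ) * (ζ / (‖ζ‖ : ℂ))) R :=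
    fun ζ hζ hlt => by
      have := real_mul_mem_ball (hunit ζ hζ) (R := R) (norm_pos_iff.2 hζ) (by linarith)
      rwa [mul_div_cancel₀ _ (by exact_mod_cast norm_ne_zero_iff.2 hζ)] at this
  let h : ℂ → ℂ := fun ζ => if ζ = 0 then borelTransform φ 0 else g (ζ / (‖ζ‖ : ℂ)) ζ
  have h0 : h =ᶠ[𝓝 0] borelTransform φ := by
    filter_upwards [ball_mem_nhds (0 : ℂ) hρ, ball_mem_nhds (0 : ℂ) (norm_pos_iff.2 hω₁)]
      with ζ h1 h2
    by_cases hζ : ζ = 0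
    · simp [h, hζ]
    · simp only [h, hζ, if_false]
      exact (hg _ (hunit ζ hζ)).2 ζ ⟨hself ζ hζ (mem_ball_zero_iff.1 h2), h1⟩
  refine ⟨h, fun ζ hζ => DifferentiableAt.differentiableWithinAt ?_, h0⟩
  by_cases hζ0 : ζ = 0
  · subst hζ0
    exact (h0.differentiableAt_iff).2 ((differentiableOn_borelTransform hφ.1).differentiableAt
      (ball_mem_nhds _ hρ))
  · have hm := hself ζ hζ0 (mem_ball_zero_iff.1 hζ)
    have : h =ᶠ[𝓝 ζ] g (ζ / (‖ζ‖ : ℂ)) := by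
      filter_upwards [isOpen_ball.mem_nhds hm, isOpen_ball.mem_nhds hζ,
        isOpen_ne.mem_nhds hζ0] with z h1 h2 h3
      have h3 : z ≠ 0 := h3
      simp only [h, h3, if_false]
      exact overlap _ _ (hunit z h3) (hunit ζ hζ0) z ⟨hself z h3 (mem_ball_zero_iff.1 h2), h1⟩
    exact this.differentiableAt_iff.2 ((hg _ (hunit ζ hζ0)).1.differentiableAt
      (isOpen_ball.mem_nhds hm))

/-- The paths may start anywhere in the disc of radius `|ω₁|`, in which the Borel transform
converges. -/
theorem IsSimpleResurgentWith.norm_period (hω₁ : ω₁ ≠ 0) (hρ : 0 < ρ)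
    (hφ : IsSimpleResurgentWith ω₁ φ ρ) : IsSimpleResurgentWith ω₁ φ ‖ω₁‖ := by
  obtain ⟨g, hg, hg0⟩ := hφ.exists_extension hω₁ hρ
  have hsum : ∀ ζ ∈ ball (0 : ℂ) ‖ω₁‖, HasSum (borelTerm φ ζ) (g ζ) := fun ζ hζ =>
    hasSum_borelTerm hg (fun n => by
      rw [hg0.iteratedDeriv_eq, iteratedDeriv_borelTransform hρ hφ.1]) hζ
  refine ⟨fun ζ hζ => (hsum ζ hζ).summable, fun γ a b hab hγ hΩ h0 => ?_⟩
  have hga := hg.analyticOnNhd isOpen_ball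
  have hgB : ∀ ζ ∈ ball (0 : ℂ) ‖ω₁‖, g =ᶠ[𝓝 ζ] borelTransform φ := fun ζ hζ => by
    filter_upwards [isOpen_ball.mem_nhds hζ] with z hz using (hsum z hz).tsum_eq.symm
  obtain ⟨s, hs0, hs1, hs⟩ : ∃ s : ℝ, 0 < s ∧ s ≤ 1 ∧ (s : ℂ) * γ a ∈ ball (0 : ℂ) ρ := by
    have hc : Tendsto (fun s : ℝ => (s : ℂ) * γ a) (𝓝[>] 0) (𝓝 0) := by
      have : ContinuousAt (fun s : ℝ => (s : ℂ) * γ a) 0 := by fun_prop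
      simpa using this.tendsto.mono_left nhdsWithin_le_nhds
    obtain ⟨s, h1, h2⟩ := ((hc.eventually (ball_mem_nhds _ hρ)).and
      (Ioc_mem_nhdsGT (zero_lt_one (α := ℝ)))).exists
    exact ⟨s, h2.1, h2.2, h1⟩
  have hseg : ∀ t ∈ Icc s 1, (t : ℂ) * γ a ∈ ball (0 : ℂ) ‖ω₁‖ ∧ (t : ℂ) * γ a ≠ 0 := fun t ht => by
    have ht0 : 0 < t := hs0.trans_le ht.1
    have hγ0 : γ a ≠ 0 := fun h => hΩ a (left_mem_Icc.2 hab) (h ▸ zero_mem _)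
    refine ⟨?_, mul_ne_zero (by exact_mod_cast ht0.ne') hγ0⟩
    rw [mem_ball_zero_iff, norm_mul, Complex.norm_real, Real.norm_of_nonneg ht0.le]
    exact (mul_le_of_le_one_left (norm_nonneg _) ht.2).trans_lt (mem_ball_zero_iff.1 h0)
  have hbr : IsBranch ω₁ ρ φ g (γ a) := by
    refine ⟨fun t : ℝ => (t : ℂ) * γ a, s, 1, fun _ => g, hs1, by fun_prop, fun t ht =>
      notMem_zmultiples (hseg t ht).2 (mem_ball_zero_iff.1 (hseg t ht).1), hs, ?_, by simp,
      EventuallyEq.rfl⟩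
    exact (IsContinuation.const fun t ht => hga _ (hseg t ht).1).congr_start
      (hgB _ (hseg s (left_mem_Icc.2 hs1)).1)
  obtain ⟨f, hf⟩ := hbr.exists_continuation hφ hab hγ hΩ
  exact ⟨f, hf.congr_start (hgB _ h0), fun ω hω =>
    (hbr.continue_along hab hγ hΩ hf).exists_hasSimpleSing hφ hω⟩

theorem mem_simpleResurgent_iff (hω₁ : ω₁ ≠ 0) :
    φ ∈ SimpleResurgent ω₁ ↔ IsSimpleResurgentWith ω₁ φ ‖ω₁‖ :=
  ⟨fun ⟨_, hρ, h⟩ => h.norm_period hω₁ hρ, fun h => ⟨_, norm_pos_iff.2 hω₁, h⟩⟩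

end Extension

/-! ### Singular data of a branch are again resurgent -/

theorem HasSimpleSing.add {G₁ G₂ : ℂ → ℂ} {ζ₁ ω a₁ a₂ : ℂ} {χ₁ χ₂ : ℂ → ℂ}
    (h₁ : HasSimpleSing G₁ ζ₁ ω a₁ χ₁) (h₂ : HasSimpleSing G₂ ζ₁ ω a₂ χ₂) :
    HasSimpleSing (fun z => G₁ z + G₂ z) ζ₁ ω (a₁ + a₂) (fun z => χ₁ z + χ₂ z) := by
  obtain ⟨hχ₁, u₁, F₁, hu₁, he₁, hF₁, hs₁⟩ := h₁
  obtain ⟨hχ₂, u₂, F₂, hu₂, he₂, hF₂, hs₂⟩ := h₂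
  refine ⟨hχ₁.add hχ₂, fun z => u₁ z + u₂ z, fun z => F₁ z + F₂ z, hu₁.add hu₂, ?_,
    hF₁.add hF₂, ?_⟩
  · filter_upwards [he₁, he₂] with z h1 h2
    rw [h1, h2]
  · filter_upwards [hs₁, hs₂] with ξ h1 h2 hξ
    simp only [h1 hξ, h2 hξ]
    ring

theorem HasSimpleSing.const_mul {G : ℂ → ℂ} {ζ₁ ω a : ℂ} {χ : ℂ → ℂ}
    (h : HasSimpleSing G ζ₁ ω a χ) (c : ℂ) :
    HasSimpleSing (fun z => c * G z) ζ₁ ω (c * a) (fun z => c * χ z) := by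
  obtain ⟨hχ, u, F, hu, he, hF, hs⟩ := h
  refine ⟨analyticAt_const.mul hχ, fun z => c * u z, fun z => c * F z, hu.const_mul c, ?_,
    analyticAt_const.mul hF, ?_⟩
  · filter_upwards [he] with z h1
    rw [h1]
  · filter_upwards [hs] with ξ h1 hξ
    simp only [h1 hξ]
    ring

theorem HasSimpleSing.translate {G : ℂ → ℂ} {ω ζ ω' a : ℂ} {χ : ℂ → ℂ}
    (h : HasSimpleSing G (ω + ζ) (ω + ω') a χ) :
    HasSimpleSing (fun z => G (ω + z)) ζ ω' a χ := by
  obtain ⟨hχ, g, F, hg, he, hF, hs⟩ := h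
  rw [dist_add_left] at hg hs
  have hball : ∀ z, z ∈ ball ζ (dist ζ ω') → ω + z ∈ ball (ω + ζ) (dist ζ ω') := fun z hz => by
    rwa [mem_ball, dist_add_left]
  refine ⟨hχ, fun z => g (ω + z), F, hg.comp (by fun_prop) hball, ?_, hF, ?_⟩
  · have : ContinuousAt (fun z => ω + z) ζ := by fun_prop
    exact this.eventually he
  · filter_upwards [hs] with ξ h1 hξ
    rw [← add_assoc, h1 (by rw [add_assoc]; exact hball _ hξ)]
    rw [add_sub_add_left_eq_sub]

/-- Nearby values of the parameter give the same branch of the logarithm. -/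
theorem logBranch_eventuallyEq {l l' : ℂ} (h : |(l - l').im| < Real.pi) :
    logBranch l =ᶠ[𝓝 (Complex.exp l)] logBranch l' := by
  have h1 : Complex.exp l / Complex.exp l = 1 := div_self (Complex.exp_ne_zero l)
  have hc : ContinuousAt (logBranch l) (Complex.exp l) :=
    (hasDerivAt_logBranch (by rw [h1]; exact Complex.one_mem_slitPlane)).continuousAt
  have hv : logBranch l (Complex.exp l) = l := by simp [logBranch]
  have hc2 : ContinuousAt (fun x => |(logBranch l x - l').im|) (Complex.exp l) :=
    (Complex.continuous_im.abs.continuousAt).comp (hc.sub continuousAt_const)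
  filter_upwards [hc2.eventually (Iio_mem_nhds (by simpa only [hv] using h)),
    isOpen_ne.mem_nhds (Complex.exp_ne_zero l)] with x hx hx0
  have hx0 : x ≠ 0 := hx0
  have he : Complex.exp (logBranch l x) = x := by
    rw [logBranch, Complex.exp_add, Complex.exp_log (div_ne_zero hx0 (Complex.exp_ne_zero l))]
    field_simp
  have := logBranch_exp (l := l') (s := logBranch l x) hx
  rw [he] at this
  exact this.symm

/-- The function `ω + ξ ↦ a / (2πi ξ) + χ(ξ) log ξ / (2πi) + F(ξ)` for the branch of the logarithm
given by `logBranch l`. -/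
noncomputable def simpleSingBranch (ω a : ℂ) (χ F : ℂ → ℂ) (l ζ : ℂ) : ℂ :=
  a / (2 * Real.pi * Complex.I * (ζ - ω)) +
    χ (ζ - ω) * (logBranch l (ζ - ω) / (2 * Real.pi * Complex.I)) + F (ζ - ω)

section

variable {ω₁ ω a : ℂ} {φ : PowerSeries ℂ} {ρ r : ℝ} {χ F : ℂ → ℂ}

theorem simpleSingBranch_eventuallyEq {l l' : ℂ} (h : |(l - l').im| < Real.pi) :
    simpleSingBranch ω a χ F l =ᶠ[𝓝 (ω + Complex.exp l)] simpleSingBranch ω a χ F l' := by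
  have hc : Tendsto (fun ζ => ζ - ω) (𝓝 (ω + Complex.exp l)) (𝓝 (Complex.exp l)) := by
    have : ContinuousAt (fun ζ => ζ - ω) (ω + Complex.exp l) := by fun_prop
    simpa [ContinuousAt] using this
  filter_upwards [hc.eventually (logBranch_eventuallyEq h)] with ζ hζ
  rw [simpleSingBranch, simpleSingBranch, hζ]

theorem analyticAt_simpleSingBranch (hχ : AnalyticOnNhd ℂ χ (ball 0 r))
    (hF : AnalyticOnNhd ℂ F (ball 0 r)) {l : ℂ} (hl : Complex.exp l ∈ ball (0 : ℂ) r) :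
    AnalyticAt ℂ (simpleSingBranch ω a χ F l) (ω + Complex.exp l) := by
  have e0 := Complex.exp_ne_zero l
  have hs : AnalyticAt ℂ (fun ζ => ζ - ω) (ω + Complex.exp l) := by fun_prop
  have hs1 : ω + Complex.exp l - ω = Complex.exp l := by ring
  have h1 : AnalyticAt ℂ (fun ζ => χ (ζ - ω)) (ω + Complex.exp l) :=
    AnalyticAt.fun_comp (by rw [hs1]; exact hχ _ hl) hs
  have h2 : AnalyticAt ℂ (fun ζ => F (ζ - ω)) (ω + Complex.exp l) :=
    AnalyticAt.fun_comp (by rw [hs1]; exact hF _ hl) hs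
  have h3 : AnalyticAt ℂ (fun ζ => logBranch l (ζ - ω)) (ω + Complex.exp l) := by
    unfold logBranch
    refine analyticAt_const.add (AnalyticAt.clog (hs.div_const) ?_)
    rw [hs1, div_self e0]
    exact Complex.one_mem_slitPlane
  have h4 : AnalyticAt ℂ (fun ζ => a / (2 * Real.pi * Complex.I * (ζ - ω)))
      (ω + Complex.exp l) := by
    refine analyticAt_const.div (by fun_prop) ?_
    rw [hs1]
    exact mul_ne_zero Complex.two_pi_I_ne_zero e0
  exact (h4.add (h1.mul h3.div_const)).add h2

/-- Near a lattice point, the branch can be continued from one determination of the logarithm to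
any other: the path is `exp` of a segment. -/
theorem IsBranch.change_log (hω : ω ∈ AddSubgroup.zmultiples ω₁) (hr : r ≤ ‖ω₁‖)
    (hχ : AnalyticOnNhd ℂ χ (ball 0 r)) (hF : AnalyticOnNhd ℂ F (ball 0 r)) {l l' : ℂ}
    (hl : Complex.exp l ∈ ball (0 : ℂ) r) (hl' : Complex.exp l' ∈ ball (0 : ℂ) r)
    (h : IsBranch ω₁ ρ φ (simpleSingBranch ω a χ F l) (ω + Complex.exp l)) :
    IsBranch ω₁ ρ φ (simpleSingBranch ω a χ F l') (ω + Complex.exp l') := by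
  set s : ℝ → ℂ := fun t => l + t * (l' - l)
  have hs0 : s 0 = l := by simp [s]
  have hs1 : s 1 = l' := by simp [s]
  have hsc : Continuous s := by fun_prop
  have hsr : ∀ t ∈ Icc (0 : ℝ) 1, Complex.exp (s t) ∈ ball (0 : ℂ) r := fun t ht => by
    rw [mem_ball_zero_iff, Complex.norm_exp] at *
    have h0 : 0 < r := (Real.exp_pos _).trans hl
    rw [← Real.lt_log_iff_exp_lt h0] at *
    have : (s t).re = (1 - t) * l.re + t * l'.re := by simp [s]; ring
    rw [this]
    rcases ht.1.eq_or_lt with rfl | h0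
    · simpa using hl
    · nlinarith [ht.2]
  have hΩ : ∀ t ∈ Icc (0 : ℝ) 1, ω + Complex.exp (s t) ∉ AddSubgroup.zmultiples ω₁ :=
    fun t ht hm => notMem_zmultiples (Complex.exp_ne_zero _)
      ((mem_ball_zero_iff.1 (hsr t ht)).trans_le hr)
      (by simpa using sub_mem hm hω)
  have hcont : IsContinuation (simpleSingBranch ω a χ F l)
      (fun t => ω + Complex.exp (s t)) 0 1
      (fun t => simpleSingBranch ω a χ F (s t)) := by
    refine ⟨fun t ht => analyticAt_simpleSingBranch hχ hF (hsr t ht), by simp [hs0], fun t ht => ?_⟩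
    refine eventually_nhdsWithin_of_eventually_nhds ?_
    have hc : ContinuousAt (fun x => |(s x - s t).im|) t := by fun_prop
    filter_upwards [hc.eventually (Iio_mem_nhds (by simpa using Real.pi_pos))] with x hx
    exact simpleSingBranch_eventuallyEq hx
  have := IsBranch.continue_along (Γ := fun t => ω + Complex.exp (s t)) (c := 0) (d := 1)
    (by simpa [hs0] using h) zero_le_one (by fun_prop) hΩ hcont
  simpa [hs1] using this

/-- The function `χ` attached to a singularity `ω` is the difference between two branches near `ω`,
which differ by a turn around `ω`. So it inherits the continuation property and the nature of
the singularities. -/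
theorem IsBranch.invBorel_mem (hω₁ : ω₁ ≠ 0) (hφ : IsSimpleResurgentWith ω₁ φ ρ) {G : ℂ → ℂ}
    {ζ₁ : ℂ} (hG : IsBranch ω₁ ρ φ G ζ₁) (hn : IsNearest ω₁ ζ₁ ω)
    (h : HasSimpleSing G ζ₁ ω a χ) : invBorel a χ ∈ SimpleResurgent ω₁ := by
  obtain ⟨hχ, g, F, hg, hgG, hF, h⟩ := h
  have hne : ζ₁ ≠ ω := hn.ne hG.notMem
  have hu : ζ₁ - ω ≠ 0 := sub_ne_zero.2 hne
  obtain ⟨r₁, hr₁, hχ⟩ := hχ.exists_ball_analyticOnNhd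
  obtain ⟨r₂, hr₂, hF⟩ := hF.exists_ball_analyticOnNhd
  obtain ⟨r₃, hr₃, h⟩ := eventually_nhds_iff_ball.1 h
  obtain ⟨r, hr, hr1, hr2, hr3, hrω⟩ : ∃ r > 0, r ≤ r₁ ∧ r ≤ r₂ ∧ r ≤ r₃ ∧ r ≤ ‖ω₁‖ :=
    ⟨min r₁ (min r₂ (min r₃ ‖ω₁‖)), by have := norm_pos_iff.2 hω₁; positivity, by simp, by simp,
      by simp, by simp⟩
  replace hχ := hχ.mono (ball_subset_ball hr1)
  replace hF := hF.mono (ball_subset_ball hr2)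
  replace h := fun ξ hξ => h ξ (ball_subset_ball hr3 hξ)
  set l := Complex.log (ζ₁ - ω)
  have hl : Complex.exp l = ζ₁ - ω := Complex.exp_log hu
  -- the point `ω + exp (l - M)` of the disc is close enough to `ω` for the expansion to hold
  obtain ⟨M, hM0, hM⟩ : ∃ M : ℝ, 0 < M ∧ l.re - M < Real.log r :=
    ⟨max 1 (l.re - Real.log r + 1), by positivity, by
      have := le_max_right 1 (l.re - Real.log r + 1); linarith⟩
  have hM1 : Real.exp (-M) < 1 := by simpa using hM0
  have hlM : Complex.exp (l - M) ∈ ball (0 : ℂ) r := by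
    rw [mem_ball_zero_iff, Complex.norm_exp, ← Real.lt_log_iff_exp_lt hr]
    simpa using hM
  have hexp : Complex.exp (l - M) = (Real.exp (-M) : ℝ) * (ζ₁ - ω) := by
    rw [sub_eq_add_neg, Complex.exp_add, hl]
    push_cast
    ring
  have hseg : ∀ t ∈ Icc (0 : ℝ) 1,
      ζ₁ + t * (ω + Complex.exp (l - M) - ζ₁) ∈ ball ζ₁ (dist ζ₁ ω) := fun t ht => by
    rw [mem_ball, dist_eq_norm, dist_eq_norm, hexp]
    have : ζ₁ + (t : ℂ) * (ω + (Real.exp (-M) : ℝ) * (ζ₁ - ω) - ζ₁) - ζ₁ =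
        -((t * (1 - Real.exp (-M)) : ℝ) : ℂ) * (ζ₁ - ω) := by
      push_cast; ring
    have hpos := Real.exp_pos (-M)
    rw [this, norm_mul, norm_neg, Complex.norm_real,
      Real.norm_of_nonneg (mul_nonneg ht.1 (by linarith))]
    have h3 : t * (1 - Real.exp (-M)) < 1 := by nlinarith [ht.1, ht.2]
    nlinarith [norm_pos_iff.2 hu]
  have hga := hg.analyticOnNhd isOpen_ball
  have b1 : IsBranch ω₁ ρ φ g (ω + Complex.exp (l - M)) := by
    have := IsBranch.continue_along (Γ := fun t : ℝ => ζ₁ + t * (ω + Complex.exp (l - M) - ζ₁))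
      (c := 0) (d := 1) (f' := fun _ => g) (by simpa using hG.congr hgG.symm) zero_le_one
      (by fun_prop) (fun t ht hm => hn.notMem_ball hm (hseg t ht))
      (IsContinuation.const fun t ht => hga _ (hseg t ht))
    simpa using this
  have hball : ω + Complex.exp (l - M) ∈ ball ζ₁ (dist ζ₁ ω) := by
    simpa using hseg 1 (by simp)
  have b2 : IsBranch ω₁ ρ φ (simpleSingBranch ω a χ F (l - M))
      (ω + Complex.exp (l - M)) := by
    refine b1.congr ?_
    have hc : ContinuousAt (fun ζ => ζ - ω) (ω + Complex.exp (l - M)) := by fun_prop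
    have e1 := hc.eventually (isOpen_ball.mem_nhds (x := ω + Complex.exp (l - M) - ω)
      (s := ball (0 : ℂ) r) (by simpa using hlM))
    have e2 := simpleSingBranch_eventuallyEq (ω := ω) (a := a) (χ := χ) (F := F)
      (l := l - M) (l' := l) (by simpa using Real.pi_pos)
    filter_upwards [e1, e2, isOpen_ball.mem_nhds hball] with ζ h1 h2 h3
    rw [h2]
    have := h (ζ - ω) h1 (by simpa using h3)
    rw [add_sub_cancel] at this
    rw [this, simpleSingBranch, logBranch, hl, add_comm l]
  have hB : ∀ ξ ∈ ball (0 : ℂ) r, borelTransform (invBorel a χ) ξ = χ ξ := fun ξ hξ =>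
    (hasSum_borelTerm hχ.differentiableOn (coeff_succ_invBorel a χ) hξ).tsum_eq
  refine ⟨r, hr, fun ξ hξ => (hasSum_borelTerm hχ.differentiableOn (coeff_succ_invBorel a χ)
    hξ).summable, fun Γ c d hcd hΓ hΓΩ h0 => ?_⟩
  have hξ0 : Γ c ≠ 0 := fun h => hΓΩ c (left_mem_Icc.2 hcd) (h ▸ zero_mem _)
  have hexp0 : Complex.exp (Complex.log (Γ c)) = Γ c := Complex.exp_log hξ0
  have hexp1 : Complex.exp (Complex.log (Γ c) + 2 * Real.pi * Complex.I) = Γ c := by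
    rw [Complex.exp_periodic, hexp0]
  have b3 := b2.change_log hn.1 hrω hχ hF hlM (l' := Complex.log (Γ c)) (by rwa [hexp0])
  have b4 := b2.change_log hn.1 hrω hχ hF hlM
    (l' := Complex.log (Γ c) + 2 * Real.pi * Complex.I) (by rwa [hexp1])
  rw [hexp0] at b3
  rw [hexp1] at b4
  have hΓ' : ContinuousOn (fun t => ω + Γ t) (Icc c d) := by fun_prop
  have hΓΩ' : ∀ t ∈ Icc c d, ω + Γ t ∉ AddSubgroup.zmultiples ω₁ := fun t ht hm =>
    hΓΩ t ht (by simpa using sub_mem hm hn.1)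
  obtain ⟨f₁, hf₁⟩ := IsBranch.exists_continuation (Γ := fun t => ω + Γ t) hφ b4 hcd hΓ' hΓΩ'
  obtain ⟨f₂, hf₂⟩ := IsBranch.exists_continuation (Γ := fun t => ω + Γ t) hφ b3 hcd hΓ' hΓΩ'
  have htr : ∀ z : ℂ, ContinuousAt (fun ξ => ω + ξ) z := fun z => by fun_prop
  refine ⟨fun t ξ => f₁ t (ω + ξ) - f₂ t (ω + ξ), ⟨fun t ht => ?_, ?_, fun t ht => ?_⟩,
    fun ω' hω' => ?_⟩
  · exact ((hf₁.analytic t ht).fun_comp (f := fun ξ => ω + ξ) (by fun_prop)).sub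
      ((hf₂.analytic t ht).fun_comp (f := fun ξ => ω + ξ) (by fun_prop))
  · filter_upwards [(htr _).eventually hf₁.start, (htr _).eventually hf₂.start,
      isOpen_ball.mem_nhds h0] with ξ h1 h2 h3
    rw [h1, h2, hB ξ h3, simpleSingBranch, simpleSingBranch, logBranch,
      logBranch, hexp0, hexp1, add_sub_cancel_left]
    have := Complex.two_pi_I_ne_zero
    have h4 : ∀ A : ℂ, A / (2 * Real.pi * Complex.I) =
      A * (2 * Real.pi * Complex.I)⁻¹ := fun A => div_eq_mul_inv _ _
    rw [h4, h4]
    linear_combination (χ ξ) * mul_inv_cancel₀ this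
  · filter_upwards [hf₁.compat t ht, hf₂.compat t ht] with s h1 h2
    filter_upwards [(htr _).eventually h1, (htr _).eventually h2] with ξ h3 h4
    rw [h3, h4]
  · obtain ⟨a₁, χ₁, s1⟩ := (b4.continue_along (Γ := fun t => ω + Γ t) hcd hΓ' hΓΩ'
      hf₁).exists_hasSimpleSing hφ (hω'.translate hn.1)
    obtain ⟨a₂, χ₂, s2⟩ := (b3.continue_along (Γ := fun t => ω + Γ t) hcd hΓ' hΓΩ'
      hf₂).exists_hasSimpleSing hφ (hω'.translate hn.1)
    refine ⟨_, _, (s1.translate.add (s2.translate.const_mul (-1))).congr ?_⟩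
    exact Eventually.of_forall fun ξ => by simp only; ring

end

/-! ### Alien operators -/

/-- The properties of a path `γ : [a, b] → ℂ` that make `𝒜_ω^γ` an operator on simple resurgent
series. -/
structure IsAlienPath (ω₁ : ℂ) (γ : ℝ → ℂ) (a b : ℝ) (ω : ℂ) : Prop where
  le : a ≤ b
  continuousOn : ContinuousOn γ (Icc a b)
  notMem : ∀ t ∈ Icc a b, γ t ∉ AddSubgroup.zmultiples ω₁
  start : γ a ∈ ball (0 : ℂ) ‖ω₁‖
  nearest : IsNearest ω₁ (γ b) ω

section AlienPath

variable {ω₁ ω : ℂ} {γ : ℝ → ℂ} {a b : ℝ} {φ φ' θ θ' : PowerSeries ℂ}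

theorem IsAlienPath.ne (hγ : IsAlienPath ω₁ γ a b ω) : γ b ≠ ω :=
  hγ.nearest.ne (hγ.notMem b (right_mem_Icc.2 hγ.le))

theorem IsAlienPath.isBranch (hγ : IsAlienPath ω₁ γ a b ω) {f : ℝ → ℂ → ℂ}
    (hf : IsContinuation (borelTransform φ) γ a b f) : IsBranch ω₁ ‖ω₁‖ φ (f b) (γ b) :=
  ⟨γ, a, b, f, hγ.le, hγ.continuousOn, hγ.notMem, hγ.start, hf, rfl, EventuallyEq.rfl⟩

theorem IsAlienPath.exists_isAlienImage (hω₁ : ω₁ ≠ 0) (hγ : IsAlienPath ω₁ γ a b ω)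
    (hφ : φ ∈ SimpleResurgent ω₁) : ∃ θ, IsAlienImage γ a b ω φ θ := by
  rw [mem_simpleResurgent_iff hω₁] at hφ
  obtain ⟨f, hf, hs⟩ := hφ.2 γ a b hγ.le hγ.continuousOn hγ.notMem hγ.start
  obtain ⟨a₀, χ, h⟩ := hs ω hγ.nearest
  exact ⟨_, f, a₀, χ, hf, h, rfl⟩

theorem IsAlienImage.mem (hω₁ : ω₁ ≠ 0) (hγ : IsAlienPath ω₁ γ a b ω)
    (hφ : φ ∈ SimpleResurgent ω₁) (h : IsAlienImage γ a b ω φ θ) : θ ∈ SimpleResurgent ω₁ := by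
  obtain ⟨f, a₀, χ, hf, hs, rfl⟩ := h
  exact (hγ.isBranch hf).invBorel_mem hω₁ ((mem_simpleResurgent_iff hω₁).1 hφ) hγ.nearest hs

theorem invBorel_congr {a₀ : ℂ} {χ χ' : ℂ → ℂ} (h : χ =ᶠ[𝓝 0] χ') :
    invBorel a₀ χ = invBorel a₀ χ' := by
  ext n
  cases n with
  | zero => simp only [coeff_zero_invBorel]
  | succ n => simp only [coeff_succ_invBorel, h.iteratedDeriv_eq]

theorem IsAlienImage.unique (hγ : IsAlienPath ω₁ γ a b ω) (h : IsAlienImage γ a b ω φ θ)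
    (h' : IsAlienImage γ a b ω φ θ') : θ = θ' := by
  obtain ⟨f, a₀, χ, hf, hs, rfl⟩ := h
  obtain ⟨f', a₀', χ', hf', hs', rfl⟩ := h'
  obtain ⟨rfl, hχ⟩ := hs.unique hγ.ne
    (hs'.congr (hf'.unique_end hf hγ.continuousOn hγ.le))
  exact invBorel_congr hχ

theorem IsAlienImage.add (hω₁ : ω₁ ≠ 0) (hγ : IsAlienPath ω₁ γ a b ω)
    (hφ : φ ∈ SimpleResurgent ω₁) (hφ' : φ' ∈ SimpleResurgent ω₁)
    (h : IsAlienImage γ a b ω φ θ) (h' : IsAlienImage γ a b ω φ' θ') :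
    IsAlienImage γ a b ω (φ + φ') (θ + θ') := by
  rw [mem_simpleResurgent_iff hω₁] at hφ hφ'
  obtain ⟨f, a₀, χ, hf, hs, rfl⟩ := h
  obtain ⟨f', a₀', χ', hf', hs', rfl⟩ := h'
  refine ⟨fun t z => f t z + f' t z, _, _, ⟨fun t ht => (hf.analytic t ht).add (hf'.analytic t ht),
    ?_, fun t ht => ?_⟩, hs.add hs', ?_⟩
  · filter_upwards [hf.start, hf'.start, isOpen_ball.mem_nhds hγ.start] with ζ h1 h2 h3
    have : borelTransform (φ + φ') ζ = borelTransform φ ζ + borelTransform φ' ζ := by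
      simp only [borelTransform, borelTerm_add]
      exact (hφ.1 ζ h3).tsum_add (hφ'.1 ζ h3)
    rw [this, h1, h2]
  · filter_upwards [hf.compat t ht, hf'.compat t ht] with s h1 h2
    exact h1.add h2
  · ext n
    cases n with
    | zero => simp only [map_add, coeff_zero_invBorel]
    | succ n =>
      simp only [map_add, coeff_succ_invBorel]
      exact (iteratedDeriv_fun_add hs.1.contDiffAt hs'.1.contDiffAt).symm

theorem IsAlienImage.smul (h : IsAlienImage γ a b ω φ θ) (c : ℂ) :
    IsAlienImage γ a b ω (c • φ) (c • θ) := by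
  obtain ⟨f, a₀, χ, hf, hs, rfl⟩ := h
  refine ⟨fun t z => c * f t z, _, _, ⟨fun t ht => analyticAt_const.mul (hf.analytic t ht),
    ?_, fun t ht => ?_⟩, hs.const_mul c, ?_⟩
  · filter_upwards [hf.start] with ζ h1
    simp only [h1, borelTransform, borelTerm_smul, tsum_mul_left]
  · filter_upwards [hf.compat t ht] with s h1
    filter_upwards [h1] with ζ h2
    rw [h2]
  · ext n
    cases n with
    | zero => simp only [map_smul, coeff_zero_invBorel, smul_eq_mul]
    | succ n =>
      simp only [map_smul, coeff_succ_invBorel, smul_eq_mul]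
      exact (iteratedDeriv_const_mul_field c χ).symm

end AlienPath

/-! ### The paths of the alien derivations -/

section CrossingPath

variable {ω₁ η : ℂ} {δ : ℝ} {m : ℕ}

theorem continuous_crossingPath (ε : Fin m → Bool) : Continuous (crossingPath η δ ε) := by
  unfold crossingPath
  fun_prop

theorem sqrt_sq_sub_sq_eq_zero (hδ₀ : 0 < δ) {y : ℝ} (hy : δ ≤ |y|) :
    Real.sqrt (δ ^ 2 - y ^ 2) = 0 := by
  refine Real.sqrt_eq_zero_of_nonpos ?_
  rw [← sq_abs y]
  nlinarith

theorem crossingPath_eq_of_forall (hδ₀ : 0 < δ) (ε : Fin m → Bool) {x : ℝ}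
    (hx : ∀ k : Fin m, δ ≤ |x - ((k : ℕ) + 1)|) : crossingPath η δ ε x = η * x := by
  unfold crossingPath
  rw [Finset.sum_eq_zero fun k _ => by rw [sqrt_sq_sub_sq_eq_zero hδ₀ (hx k), mul_zero]]
  simp

theorem crossingPath_start (hδ₀ : 0 < δ) (hδ : δ < 1 / 2) (ε : Fin m → Bool) :
    crossingPath η δ ε δ = η * δ :=
  crossingPath_eq_of_forall hδ₀ ε fun k => by
    rw [abs_sub_comm]
    refine le_trans ?_ (le_abs_self _)
    have : (0 : ℝ) ≤ (k : ℕ) := Nat.cast_nonneg _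
    linarith

theorem crossingPath_end (hδ₀ : 0 < δ) (hδ : δ < 1 / 2) (ε : Fin m → Bool) :
    crossingPath η δ ε (m + 1 - δ) = η * ((m + 1 - δ : ℝ) : ℂ) :=
  crossingPath_eq_of_forall hδ₀ ε fun k => by
    refine le_trans ?_ (le_abs_self _)
    have : ((k : ℕ) : ℝ) + 1 ≤ m := by exact_mod_cast k.2
    linarith

theorem crossingPath_notMem (hη : η ≠ 0) (hδ₀ : 0 < δ) (hδ : δ < 1 / 2) (ε : Fin m → Bool) {x : ℝ}
    (hx : x ∈ Icc δ (m + 1 - δ)) : crossingPath η δ ε x ∉ AddSubgroup.zmultiples η := by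
  intro h
  obtain ⟨n, hn⟩ := AddSubgroup.mem_zmultiples_iff.1 h
  rw [zsmul_eq_mul, mul_comm, crossingPath] at hn
  have hn := mul_left_cancel₀ hη hn
  set s : ℝ := ∑ k : Fin m, (if ε k then 1 else -1) * Real.sqrt (δ ^ 2 - (x - ((k : ℕ) + 1)) ^ 2)
    with hs
  have hre : (n : ℝ) = x := by simpa using congrArg Complex.re hn
  have him : s = 0 := by simpa using congrArg Complex.im hn
  have h0 : 0 < n := by
    have : (0 : ℝ) < n := by rw [hre]; linarith [hx.1]
    exact_mod_cast this
  have h1 : n < m + 1 := by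
    have : (n : ℝ) < m + 1 := by rw [hre]; linarith [hx.2]
    exact_mod_cast this
  -- at the integer point `n` the only half-circle that matters is the one around `n η`
  obtain ⟨k, hk⟩ : ∃ k : Fin m, ((k : ℕ) : ℤ) + 1 = n :=
    ⟨⟨(n - 1).toNat, by omega⟩, by simp; omega⟩
  have hxk : x = ((k : ℕ) : ℝ) + 1 := by rw [← hre, ← hk]; push_cast; rfl
  rw [hs, Finset.sum_eq_single k] at him
  · rw [hxk, sub_self, zero_pow two_ne_zero, sub_zero, Real.sqrt_sq hδ₀.le] at him
    split_ifs at him <;> linarith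
  · intro j _ hj
    rw [sqrt_sq_sub_sq_eq_zero hδ₀, mul_zero]
    rw [hxk, add_sub_add_right_eq_sub]
    have hne : ((k : ℕ) : ℤ) - (j : ℕ) ≠ 0 := fun h => hj (Fin.ext (by omega))
    have : (1 : ℝ) ≤ |((k : ℕ) : ℝ) - (j : ℕ)| := by exact_mod_cast Int.one_le_abs hne
    linarith
  · simp

theorem isAlienPath_crossingPath (hω₁ : ω₁ ≠ 0) (hδ₀ : 0 < δ) (hδ : δ < 1 / 2)
    (hη : η = ω₁ ∨ η = -ω₁) {ω : ℂ} (hω : ω = (m + 1) * η) (ε : Fin m → Bool) :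
    IsAlienPath ω₁ (crossingPath η δ ε) δ (m + 1 - δ) ω := by
  have hz : AddSubgroup.zmultiples ω₁ = AddSubgroup.zmultiples η := by
    rcases hη with rfl | rfl
    · rfl
    · rw [AddSubgroup.zmultiples_neg]
  have hη0 : η ≠ 0 := by rcases hη with rfl | rfl <;> simpa using hω₁
  have hnorm : ‖η‖ = ‖ω₁‖ := by rcases hη with rfl | rfl <;> simp
  have hpos : 0 < ‖η‖ := norm_pos_iff.2 hη0
  have hm : (0 : ℝ) ≤ m := Nat.cast_nonneg m
  refine ⟨by linarith, (continuous_crossingPath ε).continuousOn, fun t ht => ?_, ?_, ?_, ?_⟩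
  · rw [hz]
    exact crossingPath_notMem hη0 hδ₀ hδ ε ht
  · rw [crossingPath_start hδ₀ hδ, mem_ball_zero_iff, norm_mul, Complex.norm_real,
      Real.norm_of_nonneg hδ₀.le, ← hnorm]
    nlinarith
  · rw [hz, hω, AddSubgroup.mem_zmultiples_iff]
    exact ⟨m + 1, by push_cast [zsmul_eq_mul]; ring⟩
  · intro ω' hω'
    rw [hz] at hω'
    obtain ⟨n, rfl⟩ := AddSubgroup.mem_zmultiples_iff.1 hω'
    rw [crossingPath_end hδ₀ hδ, hω, zsmul_eq_mul]
    have e1 : η * ((m + 1 - δ : ℝ) : ℂ) - (m + 1) * η = ((-δ : ℝ) : ℂ) * η := by push_cast; ring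
    have e2 : η * ((m + 1 - δ : ℝ) : ℂ) - n * η = ((((m + 1 - n : ℤ) : ℝ) - δ : ℝ) : ℂ) * η := by
      push_cast; ring
    rw [dist_eq_norm, dist_eq_norm, e1, e2, norm_mul, norm_mul, Complex.norm_real,
      Complex.norm_real, Real.norm_eq_abs, Real.norm_eq_abs, abs_neg, abs_of_pos hδ₀]
    refine mul_le_mul_of_nonneg_right ?_ hpos.le
    rcases le_or_gt (m + 1 - n : ℤ) 0 with h | h
    · have : ((m + 1 - n : ℤ) : ℝ) ≤ 0 := by exact_mod_cast h
      rw [abs_of_nonpos (by linarith)]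
      linarith
    · have : (1 : ℝ) ≤ ((m + 1 - n : ℤ) : ℝ) := by exact_mod_cast h
      rw [abs_of_nonneg (by linarith)]
      linarith

theorem exists_eq_succ_mul (ω : Letter ω₁) :
    ∃ (η : ℂ) (m : ℕ), (η = ω₁ ∨ η = -ω₁) ∧ (ω : ℂ) = (m + 1) * η := by
  obtain ⟨n, hn⟩ := AddSubgroup.mem_zmultiples_iff.1 ω.2.1
  have hn0 : n ≠ 0 := by
    rintro rfl
    exact ω.2.2 (by simpa using hn.symm)
  rw [zsmul_eq_mul] at hn
  rcases lt_or_gt_of_ne hn0 with h | h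
  · obtain ⟨m, hm⟩ : ∃ m : ℕ, n = -(m + 1) := ⟨(-n - 1).toNat, by omega⟩
    exact ⟨-ω₁, m, Or.inr rfl, by rw [← hn, hm]; push_cast; ring⟩
  · obtain ⟨m, hm⟩ : ∃ m : ℕ, n = m + 1 := ⟨(n - 1).toNat, by omega⟩
    exact ⟨ω₁, m, Or.inl rfl, by rw [← hn, hm]; push_cast; ring⟩

theorem succ_mul_injective (hω₁ : ω₁ ≠ 0) {η' : ℂ} {m' : ℕ} (hη : η = ω₁ ∨ η = -ω₁)
    (hη' : η' = ω₁ ∨ η' = -ω₁) (h : ((m : ℂ) + 1) * η = (m' + 1) * η') : η = η' ∧ m = m' := by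
  have pos : ∀ k : ℕ, (0 : ℝ) ≤ k := fun k => Nat.cast_nonneg k
  have key : ∀ c : ℝ, (c : ℂ) * ω₁ = 0 → c = 0 := fun c hc => by
    simpa [hω₁] using hc
  rcases hη with rfl | rfl <;> rcases hη' with rfl | rfl
  · have := key (m - m') (by push_cast; linear_combination h)
    exact ⟨rfl, by exact_mod_cast sub_eq_zero.1 this⟩
  · have := key (m + 1 + (m' + 1)) (by push_cast; linear_combination h)
    linarith [pos m, pos m']
  · have := key (m + 1 + (m' + 1)) (by push_cast; linear_combination -h)
    linarith [pos m, pos m']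
  · have := key (m - m') (by push_cast; linear_combination -h)
    exact ⟨rfl, by exact_mod_cast sub_eq_zero.1 this⟩

end CrossingPath

/-! ### The alien derivations as operators -/

section AlienDerivative

variable {ω₁ : ℂ} {δ : ℝ} {ω : Letter ω₁} {φ φ' ψ ψ' : PowerSeries ℂ}

theorem exists_isAlienDerivative (hω₁ : ω₁ ≠ 0) (hδ₀ : 0 < δ) (hδ : δ < 1 / 2)
    (ω : Letter ω₁) (hφ : φ ∈ SimpleResurgent ω₁) : ∃ ψ, IsAlienDerivative ω₁ δ ω φ ψ := by
  obtain ⟨η, m, hη, hω⟩ := exists_eq_succ_mul ω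
  choose θ hθ using fun ε : Fin m → Bool =>
    (isAlienPath_crossingPath hω₁ hδ₀ hδ hη hω ε).exists_isAlienImage hω₁ hφ
  exact ⟨_, η, m, θ, hη, hω, hθ, rfl⟩

/-- The writing `ω = (m + 1) η` is unique, so two alien derivatives of the same index are sums
over the same paths. -/
theorem IsAlienDerivative.exists_common (hω₁ : ω₁ ≠ 0) (h : IsAlienDerivative ω₁ δ ω φ ψ)
    (h' : IsAlienDerivative ω₁ δ ω φ' ψ') :
    ∃ (η : ℂ) (m : ℕ) (θ θ' : (Fin m → Bool) → PowerSeries ℂ),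
      (η = ω₁ ∨ η = -ω₁) ∧ (ω : ℂ) = (m + 1) * η ∧
      (∀ ε, IsAlienImage (crossingPath η δ ε) δ (m + 1 - δ) ω φ (θ ε)) ∧
      (∀ ε, IsAlienImage (crossingPath η δ ε) δ (m + 1 - δ) ω φ' (θ' ε)) ∧
      ψ = ∑ ε, weight ε • θ ε ∧ ψ' = ∑ ε, weight ε • θ' ε := by
  obtain ⟨η, m, θ, hη, hω, hθ, hψ⟩ := h
  obtain ⟨η', m', θ', hη', hω', hθ', hψ'⟩ := h'
  obtain ⟨rfl, rfl⟩ := succ_mul_injective hω₁ hη hη' (hω.symm.trans hω')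
  exact ⟨η, m, θ, θ', hη, hω, hθ, hθ', hψ, hψ'⟩

theorem IsAlienDerivative.unique (hω₁ : ω₁ ≠ 0) (hδ₀ : 0 < δ) (hδ : δ < 1 / 2)
    (h : IsAlienDerivative ω₁ δ ω φ ψ) (h' : IsAlienDerivative ω₁ δ ω φ ψ') : ψ = ψ' := by
  obtain ⟨η, m, θ, θ', hη, hω, hθ, hθ', rfl, rfl⟩ := h.exists_common hω₁ h'
  refine Finset.sum_congr rfl fun ε _ => ?_
  rw [(hθ ε).unique (isAlienPath_crossingPath hω₁ hδ₀ hδ hη hω ε) (hθ' ε)]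

theorem IsAlienDerivative.mem (hω₁ : ω₁ ≠ 0) (hδ₀ : 0 < δ) (hδ : δ < 1 / 2)
    (hφ : φ ∈ SimpleResurgent ω₁) (h : IsAlienDerivative ω₁ δ ω φ ψ) :
    ψ ∈ SimpleResurgent ω₁ := by
  obtain ⟨η, m, θ, hη, hω, hθ, rfl⟩ := h
  exact sum_mem fun ε _ => Submodule.smul_mem _ _
    ((hθ ε).mem hω₁ (isAlienPath_crossingPath hω₁ hδ₀ hδ hη hω ε) hφ)

theorem IsAlienDerivative.add (hω₁ : ω₁ ≠ 0) (hδ₀ : 0 < δ) (hδ : δ < 1 / 2)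
    (hφ : φ ∈ SimpleResurgent ω₁) (hφ' : φ' ∈ SimpleResurgent ω₁)
    (h : IsAlienDerivative ω₁ δ ω φ ψ) (h' : IsAlienDerivative ω₁ δ ω φ' ψ') :
    IsAlienDerivative ω₁ δ ω (φ + φ') (ψ + ψ') := by
  obtain ⟨η, m, θ, θ', hη, hω, hθ, hθ', rfl, rfl⟩ := h.exists_common hω₁ h'
  refine ⟨η, m, fun ε => θ ε + θ' ε, hη, hω, fun ε =>
    (hθ ε).add hω₁ (isAlienPath_crossingPath hω₁ hδ₀ hδ hη hω ε) hφ hφ' (hθ' ε), ?_⟩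
  simp only [smul_add, Finset.sum_add_distrib]

theorem IsAlienDerivative.smul (h : IsAlienDerivative ω₁ δ ω φ ψ) (c : ℂ) :
    IsAlienDerivative ω₁ δ ω (c • φ) (c • ψ) := by
  obtain ⟨η, m, θ, hη, hω, hθ, rfl⟩ := h
  refine ⟨η, m, fun ε => c • θ ε, hη, hω, fun ε => (hθ ε).smul c, ?_⟩
  simp only [Finset.smul_sum, smul_comm c]

theorem exists_alienDerivation (hω₁ : ω₁ ≠ 0) (hδ₀ : 0 < δ) (hδ : δ < 1 / 2) :
    ∃ D : Letter ω₁ → Module.End ℂ (SimpleResurgent ω₁),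
      ∀ (ω : Letter ω₁) (φ : SimpleResurgent ω₁) (ψ : PowerSeries ℂ),
        (D ω φ : PowerSeries ℂ) = ψ ↔ IsAlienDerivative ω₁ δ ω φ ψ := by
  choose T hT using fun (ω : Letter ω₁) (φ : SimpleResurgent ω₁) =>
    exists_isAlienDerivative hω₁ hδ₀ hδ ω φ.2
  refine ⟨fun ω => { toFun := fun φ => ⟨T ω φ, (hT ω φ).mem hω₁ hδ₀ hδ φ.2⟩,
                     map_add' := fun φ φ' => Subtype.ext ?_,
                     map_smul' := fun c φ => Subtype.ext ?_ }, fun ω φ ψ => ⟨?_, fun h => ?_⟩⟩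
  · exact (hT ω _).unique hω₁ hδ₀ hδ ((hT ω φ).add hω₁ hδ₀ hδ φ.2 φ'.2 (hT ω φ'))
  · exact (hT ω _).unique hω₁ hδ₀ hδ ((hT ω φ).smul c)
  · rintro rfl
    exact hT ω φ
  · exact (hT ω φ).unique hω₁ hδ₀ hδ h

end AlienDerivative

/-! ### Primitives along paths -/

/-- Primitives can be continued along with the germs. Primitives of a germ differ by constants, so
the times up to which a continuation exists form an open and closed set. -/
theorem IsContinuation.exists_primitive {φ Φ : ℂ → ℂ} {γ : ℝ → ℂ} {a b : ℝ} {f : ℝ → ℂ → ℂ}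
    (hf : IsContinuation φ γ a b f) (hab : a ≤ b) (hγ : ContinuousOn γ (Icc a b))
    (hΦ : ∀ᶠ z in 𝓝 (γ a), HasDerivAt Φ (φ z) z) :
    ∃ F, IsContinuation Φ γ a b F ∧
      ∀ t ∈ Icc a b, ∀ᶠ z in 𝓝 (γ t), HasDerivAt (F t) (f t z) z := by
  let R : ℝ → ℝ → Prop := fun s t => ∀ Φ : ℂ → ℂ, (∀ᶠ z in 𝓝 (γ s), HasDerivAt Φ (f s z) z) →
    ∃ F, IsContinuation Φ γ s t F ∧
      ∀ u ∈ Icc s t, ∀ᶠ z in 𝓝 (γ u), HasDerivAt (F u) (f u z) z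
  have R_trans : ∀ s t u, a ≤ s → s ≤ t → t ≤ u → u ≤ b → R s t → R t u → R s u := by
    intro s t u has hst htu hub h1 h2 Φ hΦ
    obtain ⟨F, hF, hFd⟩ := h1 Φ hΦ
    obtain ⟨F', hF', hFd'⟩ := h2 (F t) (hFd t ⟨hst, le_rfl⟩)
    refine ⟨_, hF.concat hF' (hγ.mono (Icc_subset_Icc has hub)) hst htu, fun v hv => ?_⟩
    by_cases hvt : v ≤ t
    · simpa [hvt] using hFd v ⟨hv.1, hvt⟩
    · simpa [hvt] using hFd' v ⟨(not_le.1 hvt).le, hv.2⟩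
  have R_left : ∀ s t u, t ≤ u → R s u → R s t := fun s t u htu h Φ hΦ => by
    obtain ⟨F, hF, hFd⟩ := h Φ hΦ
    exact ⟨F, hF.left htu, fun v hv => hFd v ⟨hv.1, hv.2.trans htu⟩⟩
  -- locally a primitive of the single germ `f x` serves for all nearby times
  have R_local : ∀ x ∈ Icc a b, ∃ ε > 0, ∀ s ∈ ball x ε ∩ Icc a b, ∀ t ∈ ball x ε ∩ Icc a b,
      s ≤ t → R s t := by
    intro x hx
    obtain ⟨p, hp, -, hpd⟩ := Resurgence.exists_primitive (hf.analytic x hx) 0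
    have h1 := (hγ x hx).eventually (hp.eventually_analyticAt.and hpd.eventually_nhds)
    obtain ⟨ε, hε, H⟩ := Metric.mem_nhdsWithin_iff.1 (h1.and (hf.compat x hx))
    refine ⟨ε, hε, fun s hs t ht hst Φ hΦ => ?_⟩
    have hsub : ∀ u ∈ Icc s t, u ∈ ball x ε ∩ Icc a b := fun u hu => by
      refine ⟨?_, hs.2.1.trans hu.1, hu.2.trans ht.2.2⟩
      have e1 := hs.1
      have e2 := ht.1
      rw [Real.ball_eq_Ioo] at e1 e2 ⊢
      exact ⟨e1.1.trans_le hu.1, hu.2.trans_lt e2.2⟩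
    have hd : ∀ u ∈ Icc s t, ∀ c : ℂ, ∀ᶠ z in 𝓝 (γ u),
        HasDerivAt (fun z => p z + c) (f u z) z := fun u hu c => by
      obtain ⟨⟨-, h2⟩, h3⟩ := H (hsub u hu)
      filter_upwards [h2, h3] with z h4 h5
      rw [h5]
      exact h4.add_const c
    refine ⟨fun _ z => p z + (Φ (γ s) - p (γ s)), ?_, fun u hu => hd u hu _⟩
    refine (IsContinuation.const fun u hu => ?_).congr_start
      (eventuallyEq_of_hasDerivAt (hd s ⟨le_rfl, hst⟩ _) hΦ (by ring))
    exact (H (hsub u hu)).1.1.add analyticAt_const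
  have key : R a a ↔ R a b := by
    refine isPreconnected_Icc.induction₂ (fun s t => R a s ↔ R a t) (fun x hx => ?_)
      (fun x y z _ _ _ h1 h2 => h1.trans h2) (fun x y _ _ h => h.symm)
      (left_mem_Icc.2 hab) (right_mem_Icc.2 hab)
    obtain ⟨ε, hε, H⟩ := R_local x hx
    filter_upwards [eventually_nhdsWithin_of_eventually_nhds (ball_mem_nhds x hε),
      self_mem_nhdsWithin] with y hy hyI
    have hxx : x ∈ ball x ε ∩ Icc a b := ⟨mem_ball_self hε, hx⟩
    rcases le_total x y with hxy | hxy
    · exact ⟨fun h => R_trans a x y le_rfl hx.1 hxy hyI.2 h (H x hxx y ⟨hy, hyI⟩ hxy),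
        R_left a x y hxy⟩
    · exact ⟨R_left a y x hxy,
        fun h => R_trans a y x le_rfl hyI.1 hxy hx.2 h (H y ⟨hy, hyI⟩ x hxx hxy)⟩
  obtain ⟨ε, hε, H⟩ := R_local a (left_mem_Icc.2 hab)
  have haa : a ∈ ball a ε ∩ Icc a b := ⟨mem_ball_self hε, left_mem_Icc.2 hab⟩
  refine key.1 (H a haa a haa le_rfl) Φ ?_
  filter_upwards [hΦ, hf.start] with z h1 h2
  rwa [h2]

/-! ### Hyperlogarithms -/

/-- The residues (polar parts) of all branches vanish at all singular points except possibly `c`. -/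
def ResiduesOnlyAt (ω₁ c : ℂ) (φ : PowerSeries ℂ) : Prop :=
  ∀ (G : ℂ → ℂ) (ζ ω a : ℂ) (χ : ℂ → ℂ), IsBranch ω₁ ‖ω₁‖ φ G ζ → IsNearest ω₁ ζ ω →
    HasSimpleSing G ζ ω a χ → ω ≠ c → a = 0

/-- The relation `(ζ - c) φ̂'(ζ) = φ₀ + ∫₀^ζ φ̂` between the Borel transforms of `φ` and `φ'`,
where `φ₀` is the constant term of `φ` and `φ'` has none. -/
structure IsHyperlogStep (ω₁ c : ℂ) (φ φ' : PowerSeries ℂ) : Prop where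
  coeff_zero : PowerSeries.coeff 0 φ' = 0
  hasDerivAt : ∀ ζ ∈ ball (0 : ℂ) ‖ω₁‖,
    HasDerivAt (fun z => (z - c) * borelTransform φ' z) (borelTransform φ ζ) ζ
  init : (0 - c) * borelTransform φ' 0 = PowerSeries.coeff 0 φ

section Hyperlog

variable {ω₁ c c' ω : ℂ} {φ φ' θ θ' : PowerSeries ℂ} {γ : ℝ → ℂ} {a b : ℝ}

/-- The relation between `φ̂` and `φ̂'` persists along every path. -/
theorem IsHyperlogStep.hasDerivAt_end (hs : IsHyperlogStep ω₁ c φ φ') {f f' : ℝ → ℂ → ℂ}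
    (hab : a ≤ b) (hγ : ContinuousOn γ (Icc a b)) (h0 : γ a ∈ ball (0 : ℂ) ‖ω₁‖)
    (hf : IsContinuation (borelTransform φ) γ a b f)
    (hf' : IsContinuation (borelTransform φ') γ a b f') :
    ∀ᶠ z in 𝓝 (γ b), HasDerivAt (fun z => (z - c) * f' b z) (f b z) z := by
  have han : ∀ t ∈ Icc a b, AnalyticAt ℂ (fun z => (z - c) * f' t z) (γ t) := fun t ht =>
    AnalyticAt.mul (by fun_prop) (hf'.analytic t ht)
  have hk : IsContinuation (borelTransform φ) γ a b
      (fun t => deriv fun z => (z - c) * f' t z) := by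
    refine ⟨fun t ht => (han t ht).deriv, ?_, fun t ht => ?_⟩
    · have : (fun z => (z - c) * f' a z) =ᶠ[𝓝 (γ a)] fun z => (z - c) * borelTransform φ' z := by
        filter_upwards [hf'.start] with z hz
        rw [hz]
      refine this.deriv.trans ?_
      filter_upwards [isOpen_ball.mem_nhds h0] with z hz
      exact (hs.hasDerivAt z hz).deriv
    · filter_upwards [hf'.compat t ht] with s h1
      refine EventuallyEq.deriv ?_
      filter_upwards [h1] with z h2
      rw [h2]
  filter_upwards [hk.unique_end hf hγ hab,
    (han b (right_mem_Icc.2 hab)).eventually_analyticAt] with z h1 h2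
  rw [← h1]
  exact h2.differentiableAt.hasDerivAt

/-- How the singular data of a branch of `φ'` follow from those of the branch of `φ`. -/
theorem singular_data_of_hasDerivAt {G G' : ℂ → ℂ} {ζ a₀ a₀' : ℂ} {χ χ' : ℂ → ℂ}
    (hc : c ∈ AddSubgroup.zmultiples ω₁) (hζ : ζ ∉ AddSubgroup.zmultiples ω₁)
    (hn : IsNearest ω₁ ζ ω) (hd : ∀ᶠ z in 𝓝 ζ, HasDerivAt (fun z => (z - c) * G' z) (G z) z)
    (h : HasSimpleSing G ζ ω a₀ χ) (h' : HasSimpleSing G' ζ ω a₀' χ') (ha : ω = c → a₀ = 0) :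
    (ω - c) * a₀' = 0 ∧ ∃ X, X 0 = a₀ ∧ (∀ᶠ ξ in 𝓝 (0 : ℂ), HasDerivAt X (χ ξ) ξ) ∧
      ∀ᶠ ξ in 𝓝 (0 : ℂ), (ξ + (ω - c)) * χ' ξ = X ξ := by
  obtain ⟨X, -, hX0, hXd, hX⟩ := h.primitive (hn.ne hζ) hd
  obtain ⟨a₁, χ₁, h1, ha1, hχ1⟩ := hX.div_sub (hn.notMem_ball hc) fun e => hX0.trans (ha e)
  have hζc : ζ ≠ c := fun e => hζ (e ▸ hc)
  have hG : (fun z => (z - c) * G' z / (z - c)) =ᶠ[𝓝 ζ] G' := by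
    filter_upwards [isOpen_ne.mem_nhds hζc] with z hz
    exact mul_div_cancel_left₀ _ (sub_ne_zero.2 hz)
  obtain ⟨rfl, hχ⟩ := h'.unique (hn.ne hζ) (h1.congr hG)
  refine ⟨ha1, X, hX0, hXd, ?_⟩
  filter_upwards [hχ1, hχ] with ξ h2 h3
  rw [h3, h2]

theorem IsHyperlogStep.residuesOnlyAt (hs : IsHyperlogStep ω₁ c' φ φ') (hω₁ : ω₁ ≠ 0)
    (hφ : φ ∈ SimpleResurgent ω₁) (hr : ResiduesOnlyAt ω₁ c φ)
    (hc' : c' ∈ AddSubgroup.zmultiples ω₁) (hcc : c' ≠ c) : ResiduesOnlyAt ω₁ c' φ' := by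
  rintro G ζ ω a₀ χ ⟨γ, a, b, f', hab, hγ, hΩ, h0, hf', rfl, hG⟩ hn hsing hne
  rw [mem_simpleResurgent_iff hω₁] at hφ
  obtain ⟨f, hf, hfs⟩ := hφ.2 γ a b hab hγ hΩ h0
  obtain ⟨a₁, χ₁, h1⟩ := hfs ω hn
  have hbr : IsBranch ω₁ ‖ω₁‖ φ (f b) (γ b) := ⟨γ, a, b, f, hab, hγ, hΩ, h0, hf, rfl,
    EventuallyEq.rfl⟩
  have := (singular_data_of_hasDerivAt hc' (hΩ b (right_mem_Icc.2 hab)) hn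
    (hs.hasDerivAt_end hab hγ h0 hf hf') h1 (hsing.congr hG.symm)
    (fun e => hr _ _ _ _ _ hbr hn h1 (e ▸ hcc))).1
  exact (mul_eq_zero.1 this).resolve_left (sub_ne_zero.2 hne)

/-- The step can be performed on a simple resurgent series whose residues are located at one
point `c ≠ c'`: then the primitive has no logarithm with nonzero coefficient at `c'` that the
division would turn into a singularity that is not simple. -/
theorem exists_isHyperlogStep (hω₁ : ω₁ ≠ 0) (hφ : φ ∈ SimpleResurgent ω₁)
    (hr : ResiduesOnlyAt ω₁ c φ) (hc' : c' ∈ AddSubgroup.zmultiples ω₁) (hcc : c' ≠ c)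
    (h0 : c' = 0 → PowerSeries.coeff 0 φ = 0) :
    ∃ φ' ∈ SimpleResurgent ω₁, IsHyperlogStep ω₁ c' φ φ' := by
  have hpos : 0 < ‖ω₁‖ := norm_pos_iff.2 hω₁
  rw [mem_simpleResurgent_iff hω₁] at hφ
  obtain ⟨Φ, hΦ0, hΦ⟩ := ((differentiableOn_borelTransform hφ.1).isExactOn_ball).with_val_at 0
    (PowerSeries.coeff 0 φ)
  have hΦd : DifferentiableOn ℂ Φ (ball 0 ‖ω₁‖) := fun z hz =>
    (hΦ z hz).differentiableAt.differentiableWithinAt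
  obtain ⟨χ, hχ, hχΦ⟩ : ∃ χ, DifferentiableOn ℂ χ (ball 0 ‖ω₁‖) ∧
      ∀ z ∈ ball (0 : ℂ) ‖ω₁‖, (z - c') * χ z = Φ z := by
    by_cases hc0 : c' = 0
    · refine ⟨dslope Φ 0, (Complex.differentiableOn_dslope (ball_mem_nhds _ hpos)).2 hΦd,
        fun z _ => ?_⟩
      have := sub_smul_dslope Φ 0 z
      rw [hc0]
      rwa [smul_eq_mul, hΦ0, h0 hc0, sub_zero (Φ z)] at this
    · have hne : ∀ z ∈ ball (0 : ℂ) ‖ω₁‖, z - c' ≠ 0 := fun z hz e =>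
        (norm_le_of_mem_zmultiples hc' hc0).not_gt (by
          rwa [sub_eq_zero.1 e, mem_ball_zero_iff] at hz)
      exact ⟨fun z => Φ z / (z - c'), hΦd.div (by fun_prop) hne, fun z hz =>
        mul_div_cancel₀ _ (hne z hz)⟩
  have hsum : ∀ z ∈ ball (0 : ℂ) ‖ω₁‖, HasSum (borelTerm (invBorel 0 χ) z) (χ z) := fun z hz =>
    hasSum_borelTerm hχ (coeff_succ_invBorel 0 χ) hz
  have hB : ∀ z ∈ ball (0 : ℂ) ‖ω₁‖, borelTransform (invBorel 0 χ) z = χ z := fun z hz =>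
    (hsum z hz).tsum_eq
  refine ⟨invBorel 0 χ, ⟨‖ω₁‖, hpos, fun z hz => (hsum z hz).summable,
    fun γ a b hab hγ hΩ hstart => ?_⟩, coeff_zero_invBorel 0 χ, fun z hz => ?_, ?_⟩
  · obtain ⟨f, hf, hfs⟩ := hφ.2 γ a b hab hγ hΩ hstart
    obtain ⟨F, hF, hFd⟩ := hf.exists_primitive hab hγ (Φ := Φ) (by
      filter_upwards [isOpen_ball.mem_nhds hstart] with z hz using hΦ z hz)
    have hne : ∀ t ∈ Icc a b, γ t ≠ c' := fun t ht e => hΩ t ht (e ▸ hc')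
    refine ⟨fun t z => F t z / (z - c'), ⟨fun t ht => ?_, ?_, fun t ht => ?_⟩, fun ω hω => ?_⟩
    · exact (hF.analytic t ht).div (by fun_prop) (sub_ne_zero.2 (hne t ht))
    · filter_upwards [hF.start, isOpen_ball.mem_nhds hstart,
        isOpen_ne.mem_nhds (hne a (left_mem_Icc.2 hab))] with z h1 h2 h3
      rw [h1, hB z h2, ← hχΦ z h2]
      exact mul_div_cancel_left₀ _ (sub_ne_zero.2 h3)
    · filter_upwards [hF.compat t ht] with s h1
      filter_upwards [h1] with z h2
      rw [h2]
    · obtain ⟨a₀, χ₀, h1⟩ := hfs ω hω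
      obtain ⟨X, -, hX0, -, hX⟩ := h1.primitive (hω.ne (hΩ b (right_mem_Icc.2 hab)))
        (hFd b (right_mem_Icc.2 hab))
      obtain ⟨a₁, χ₁, h2, -⟩ := hX.div_sub (hω.notMem_ball hc') fun e =>
        hX0.trans (hr _ _ _ _ _ ⟨γ, a, b, f, hab, hγ, hΩ, hstart, hf, rfl, EventuallyEq.rfl⟩
          hω h1 (e ▸ hcc))
      exact ⟨a₁, χ₁, h2⟩
  · refine (hΦ z hz).congr_of_eventuallyEq ?_
    filter_upwards [isOpen_ball.mem_nhds hz] with w hw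
    rw [hB w hw, hχΦ w hw]
  · rw [hB 0 (mem_ball_self hpos), hχΦ 0 (mem_ball_self hpos), hΦ0]

/-- The relation `(-d/dz + q) θ' = z⁻¹ θ` between formal series, coefficientwise. On Borel
transforms it reads `(ζ + q) θ̂'(ζ) = θ₀ + ∫₀^ζ θ̂`. -/
def FormalStep (q : ℂ) (θ θ' : PowerSeries ℂ) : Prop :=
  q * PowerSeries.coeff 0 θ' = 0 ∧
    ∀ n : ℕ, n * PowerSeries.coeff n θ' + q * PowerSeries.coeff (n + 1) θ' = PowerSeries.coeff n θ

theorem iteratedDeriv_id_add_mul {χ : ℂ → ℂ} (hχ : AnalyticAt ℂ χ 0) (q : ℂ) (n : ℕ) :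
    iteratedDeriv (n + 1) (fun ξ => (ξ + q) * χ ξ) =ᶠ[𝓝 0]
      fun ξ => (n + 1) * iteratedDeriv n χ ξ + (ξ + q) * iteratedDeriv (n + 1) χ ξ := by
  have hd : ∀ n : ℕ, ∀ᶠ ξ in 𝓝 (0 : ℂ), HasDerivAt (iteratedDeriv n χ)
      (iteratedDeriv (n + 1) χ ξ) ξ := fun n => by
    filter_upwards [hχ.eventually_analyticAt] with ξ hξ
    rw [iteratedDeriv_succ, iteratedDeriv_eq_iterate]
    exact (AnalyticAt.iterated_deriv hξ n).differentiableAt.hasDerivAt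
  induction n with
  | zero =>
    filter_upwards [hd 0] with ξ h
    have := ((hasDerivAt_id ξ).add_const q).mul h
    simp only [iteratedDeriv_zero] at this
    rw [iteratedDeriv_one]
    refine this.deriv.trans ?_
    simp
  | succ n ih =>
    rw [iteratedDeriv_succ]
    refine ih.deriv.trans ?_
    filter_upwards [hd n, hd (n + 1)] with ξ h1 h2
    have := (h1.const_mul ((n : ℂ) + 1)).add (((hasDerivAt_id ξ).add_const q).mul h2)
    refine this.deriv.trans ?_
    push_cast
    simp only [id]
    ring

theorem formalStep_of_eventually {q : ℂ} {χ χ' X : ℂ → ℂ} (hχ' : AnalyticAt ℂ χ' 0)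
    (hθ : ∀ n, PowerSeries.coeff (n + 1) θ = iteratedDeriv n χ 0)
    (hθ' : ∀ n, PowerSeries.coeff (n + 1) θ' = iteratedDeriv n χ' 0)
    (h0 : q * PowerSeries.coeff 0 θ' = 0) (hX0 : X 0 = PowerSeries.coeff 0 θ)
    (hX : ∀ᶠ ξ in 𝓝 (0 : ℂ), HasDerivAt X (χ ξ) ξ)
    (h : ∀ᶠ ξ in 𝓝 (0 : ℂ), (ξ + q) * χ' ξ = X ξ) : FormalStep q θ θ' := by
  refine ⟨h0, fun n => ?_⟩
  cases n with
  | zero =>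
    rw [hθ', ← hX0, ← h.self_of_nhds]
    simp
  | succ n =>
    have e1 : iteratedDeriv (n + 1) X 0 = iteratedDeriv n χ 0 := by
      rw [iteratedDeriv_succ']
      refine EventuallyEq.iteratedDeriv_eq n ?_
      filter_upwards [hX] with ξ hξ using hξ.deriv
    have e2 := (show (fun ξ => (ξ + q) * χ' ξ) =ᶠ[𝓝 0] X from h).iteratedDeriv_eq (n + 1)
    rw [(iteratedDeriv_id_add_mul hχ' q n).self_of_nhds, e1] at e2
    rw [hθ, hθ', hθ', ← e2]
    push_cast
    ring

theorem IsHyperlogStep.formalStep (hs : IsHyperlogStep ω₁ c φ φ') (hω₁ : ω₁ ≠ 0)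
    (hφ : φ ∈ SimpleResurgent ω₁) (hφ' : φ' ∈ SimpleResurgent ω₁) : FormalStep (-c) φ φ' := by
  have hpos : 0 < ‖ω₁‖ := norm_pos_iff.2 hω₁
  rw [mem_simpleResurgent_iff hω₁] at hφ hφ'
  refine formalStep_of_eventually (χ := borelTransform φ) (χ' := borelTransform φ')
    (X := fun z => (z - c) * borelTransform φ' z)
    ((differentiableOn_borelTransform hφ'.1).analyticAt (ball_mem_nhds _ hpos))
    (fun n => (iteratedDeriv_borelTransform hpos hφ.1 n).symm)
    (fun n => (iteratedDeriv_borelTransform hpos hφ'.1 n).symm) ?_ hs.init ?_ ?_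
  · rw [hs.coeff_zero, mul_zero]
  · filter_upwards [ball_mem_nhds 0 hpos] with z hz using hs.hasDerivAt z hz
  · exact Eventually.of_forall fun ξ => by ring

/-- The alien operators commute with `z⁻¹`, and multiplication by `ζ - c` becomes multiplication by
`ζ + ω - c`. -/
theorem IsHyperlogStep.formalStep_alienImage (hs : IsHyperlogStep ω₁ c' φ φ')
    (hr : ResiduesOnlyAt ω₁ c φ) (hc' : c' ∈ AddSubgroup.zmultiples ω₁) (hcc : c' ≠ c)
    (hγ : IsAlienPath ω₁ γ a b ω) (h : IsAlienImage γ a b ω φ θ)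
    (h' : IsAlienImage γ a b ω φ' θ') : FormalStep (ω - c') θ θ' := by
  obtain ⟨f, a₀, χ, hf, hfs, rfl⟩ := h
  obtain ⟨f', a₀', χ', hf', hfs', rfl⟩ := h'
  obtain ⟨h1, X, hX0, hX, hX'⟩ := singular_data_of_hasDerivAt hc'
    (hγ.notMem b (right_mem_Icc.2 hγ.le)) hγ.nearest
    (hs.hasDerivAt_end hγ.le hγ.continuousOn hγ.start hf hf') hfs hfs'
    (fun e => hr _ _ _ _ _ (hγ.isBranch hf) hγ.nearest hfs (e ▸ hcc))
  exact formalStep_of_eventually hfs'.1 (coeff_succ_invBorel _ _) (coeff_succ_invBorel _ _)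
    (by rwa [coeff_zero_invBorel]) (by rwa [coeff_zero_invBorel]) hX hX'

theorem FormalStep.smul {q : ℂ} (h : FormalStep q θ θ') (k : ℂ) :
    FormalStep q (k • θ) (k • θ') := by
  refine ⟨?_, fun n => ?_⟩ <;> simp only [map_smul, smul_eq_mul]
  · linear_combination k * h.1
  · linear_combination k * h.2 n

theorem FormalStep.sum {ι : Type*} {q : ℂ} {s : Finset ι} {θ θ' : ι → PowerSeries ℂ}
    (h : ∀ i ∈ s, FormalStep q (θ i) (θ' i)) :
    FormalStep q (∑ i ∈ s, θ i) (∑ i ∈ s, θ' i) := by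
  refine ⟨?_, fun n => ?_⟩ <;> simp only [map_sum, Finset.mul_sum]
  · exact Finset.sum_eq_zero fun i hi => (h i hi).1
  · rw [← Finset.sum_add_distrib]
    exact Finset.sum_congr rfl fun i hi => (h i hi).2 n

theorem IsHyperlogStep.formalStep_alienDerivative {δ : ℝ} {ω : Letter ω₁} {ψ ψ' : PowerSeries ℂ}
    (hs : IsHyperlogStep ω₁ c' φ φ') (hω₁ : ω₁ ≠ 0) (hδ₀ : 0 < δ) (hδ : δ < 1 / 2)
    (hr : ResiduesOnlyAt ω₁ c φ) (hc' : c' ∈ AddSubgroup.zmultiples ω₁) (hcc : c' ≠ c)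
    (h : IsAlienDerivative ω₁ δ ω φ ψ) (h' : IsAlienDerivative ω₁ δ ω φ' ψ') :
    FormalStep (ω - c') ψ ψ' := by
  obtain ⟨η, m, θ, θ', hη, hω, hθ, hθ', rfl, rfl⟩ := h.exists_common hω₁ h'
  exact FormalStep.sum fun ε _ => (hs.formalStep_alienImage hr hc' hcc
    (isAlienPath_crossingPath hω₁ hδ₀ hδ hη hω ε) (hθ ε) (hθ' ε)).smul _

/-! ### The series `1` and the simple poles -/

theorem borelTransform_one : borelTransform 1 = fun _ => 0 := by
  funext ζ
  simp [borelTransform, borelTerm, PowerSeries.coeff_one]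

theorem hasSimpleSing_zero {ζ₁ : ℂ} : HasSimpleSing (fun _ => 0) ζ₁ ω 0 fun _ => 0 :=
  ⟨analyticAt_const, fun _ => 0, fun _ => 0, differentiableOn_const 0, EventuallyEq.rfl,
    analyticAt_const, Eventually.of_forall fun ξ _ => by simp⟩

theorem one_mem : (1 : PowerSeries ℂ) ∈ SimpleResurgent ω₁ := by
  refine ⟨1, one_pos, fun ζ _ => ?_, fun γ a b _ _ _ _ => ⟨fun _ _ => 0, ?_, fun ω _ =>
    ⟨_, _, hasSimpleSing_zero⟩⟩⟩
  · have : borelTerm 1 ζ = fun _ => 0 := by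
      funext n
      simp [borelTerm, PowerSeries.coeff_one]
    rw [this]
    exact summable_zero
  · rw [borelTransform_one]
    exact IsContinuation.const fun _ _ => analyticAt_const

/-- The Borel transform of `1` is zero, so `1` has no residue at all and `c` is arbitrary. -/
theorem residuesOnlyAt_one (c : ℂ) : ResiduesOnlyAt ω₁ c 1 := by
  rintro G ζ ω a₀ χ ⟨γ, a, b, f, hab, hγ, hΩ, h0, hf, rfl, hG⟩ hn hs -
  rw [borelTransform_one] at hf
  have h1 := hf.unique_end (IsContinuation.const fun _ _ => analyticAt_const) hγ hab
  exact (hs.unique (hn.ne (hΩ b (right_mem_Icc.2 hab)))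
    (hasSimpleSing_zero.congr (h1.symm.trans hG))).1

theorem isAlienImage_one (hγ : IsAlienPath ω₁ γ a b ω) (h : IsAlienImage γ a b ω 1 θ) : θ = 0 := by
  refine h.unique hγ ⟨fun _ _ => 0, 0, fun _ => 0, ?_, hasSimpleSing_zero, ?_⟩
  · rw [borelTransform_one]
    exact IsContinuation.const fun _ _ => analyticAt_const
  · ext n
    cases n with
    | zero => rw [coeff_zero_invBorel, map_zero]
    | succ n => rw [coeff_succ_invBorel, map_zero, iteratedDeriv_fun_const_zero]

theorem isAlienDerivative_one {δ : ℝ} {ω : Letter ω₁} {ψ : PowerSeries ℂ} (hω₁ : ω₁ ≠ 0)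
    (hδ₀ : 0 < δ) (hδ : δ < 1 / 2) (h : IsAlienDerivative ω₁ δ ω 1 ψ) : ψ = 0 := by
  obtain ⟨η, m, θ, hη, hω, hθ, rfl⟩ := h
  refine Finset.sum_eq_zero fun ε _ => ?_
  rw [isAlienImage_one (isAlienPath_crossingPath hω₁ hδ₀ hδ hη hω ε) (hθ ε), smul_zero]

/-- For `φ = 1` the step gives `φ̂' = 1 / (ζ - ω)`, whose polar part at `ω` is the same on every
path. -/
theorem IsHyperlogStep.coeff_zero_alienImage (hω₁ : ω₁ ≠ 0) (hγ : IsAlienPath ω₁ γ a b ω)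
    (hs : IsHyperlogStep ω₁ ω 1 φ') (h : IsAlienImage γ a b ω φ' θ) :
    PowerSeries.coeff 0 θ = 2 * Real.pi * Complex.I := by
  have hpos : 0 < ‖ω₁‖ := norm_pos_iff.2 hω₁
  have hne : ∀ t ∈ Icc a b, γ t ≠ ω := fun t ht e => hγ.notMem t ht (e ▸ hγ.nearest.1)
  have hB : ∀ z ∈ ball (0 : ℂ) ‖ω₁‖, (z - ω) * borelTransform φ' z = 1 := by
    obtain ⟨k, hk⟩ := exists_const_of_hasDerivAt (f := fun z => (z - ω) * borelTransform φ' z)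
      (g := fun _ => 0) (h := fun _ => 0) isOpen_ball (convex_ball (0 : ℂ) ‖ω₁‖).isPreconnected
      (fun z hz => by simpa [borelTransform_one] using hs.hasDerivAt z hz)
      (fun z _ => hasDerivAt_const z 0)
    have h1 := hs.init
    rw [show PowerSeries.coeff 0 (1 : PowerSeries ℂ) = 1 by simp] at h1
    intro z hz
    have h2 := hk 0 (mem_ball_self hpos)
    rw [h1] at h2
    rw [hk z hz, h2]
  have hcont : IsContinuation (borelTransform φ') γ a b fun _ z => 1 / (z - ω) := by
    refine (IsContinuation.const fun t ht => ?_).congr_start ?_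
    · exact analyticAt_const.div (by fun_prop) (sub_ne_zero.2 (hne t ht))
    · filter_upwards [isOpen_ball.mem_nhds hγ.start,
        isOpen_ne.mem_nhds (hne a (left_mem_Icc.2 hγ.le))] with z h1 h2
      rw [← hB z h1]
      exact mul_div_cancel_left₀ _ (sub_ne_zero.2 h2)
  have hsing : HasSimpleSing (fun z => 1 / (z - ω)) (γ b) ω (2 * Real.pi * Complex.I)
      fun _ => 0 := by
    refine ⟨analyticAt_const, _, fun _ => 0, ?_, EventuallyEq.rfl, analyticAt_const,
      Eventually.of_forall fun ξ hξ => ?_⟩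
    · refine (differentiableOn_const _).div (by fun_prop) fun z hz e => ?_
      rw [sub_eq_zero.1 e] at hz
      exact hγ.nearest.notMem_ball hγ.nearest.1 hz
    · have := ne_zero_of_add_mem_ball hξ
      have := Real.pi_ne_zero
      rw [add_sub_cancel_left]
      field_simp
      ring
  rw [h.unique hγ ⟨_, _, _, hcont, hsing, rfl⟩, coeff_zero_invBorel]

theorem sum_weight_ne_zero (m : ℕ) : ∑ ε : Fin m → Bool, weight ε ≠ 0 := by
  have h : ∀ ε : Fin m → Bool, ∃ x : ℝ, 0 < x ∧ weight ε = x := fun ε => by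
    refine ⟨((Finset.univ.filter fun k => ε k = true).card.factorial : ℝ) *
      ((Finset.univ.filter fun k => ε k = false).card.factorial : ℝ) / ((m + 1).factorial : ℝ), ?_,
      ?_⟩
    · have := Nat.factorial_pos
      positivity
    · simp [weight]
  choose x hx hw using h
  simp only [hw]
  rw [← Complex.ofReal_sum]
  exact_mod_cast (Finset.sum_pos (fun ε _ => hx ε) Finset.univ_nonempty).ne'

theorem IsHyperlogStep.coeff_zero_alienDerivative {δ : ℝ} {ω : Letter ω₁} {ψ : PowerSeries ℂ}
    (hω₁ : ω₁ ≠ 0) (hδ₀ : 0 < δ) (hδ : δ < 1 / 2) (hs : IsHyperlogStep ω₁ ω 1 φ')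
    (h : IsAlienDerivative ω₁ δ ω φ' ψ) : PowerSeries.coeff 0 ψ ≠ 0 := by
  obtain ⟨η, m, θ, hη, hω, hθ, rfl⟩ := h
  simp only [map_sum, map_smul, smul_eq_mul]
  rw [Finset.sum_congr rfl fun ε _ => by
    rw [hs.coeff_zero_alienImage hω₁ (isAlienPath_crossingPath hω₁ hδ₀ hδ hη hω ε) (hθ ε)],
    ← Finset.sum_mul]
  exact mul_ne_zero (sum_weight_ne_zero m) Complex.two_pi_I_ne_zero

end Hyperlog

/-! ### Resurgence monomials -/

section Monomials

variable {ω₁ : ℂ}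

/-- The sum of the letters of a word. -/
noncomputable def wordSum (w : List (Letter ω₁)) : ℂ := (w.map fun x => (x : ℂ)).sum

@[simp] theorem wordSum_nil : wordSum ([] : List (Letter ω₁)) = 0 := rfl

@[simp] theorem wordSum_cons (x : Letter ω₁) (w : List (Letter ω₁)) :
    wordSum (x :: w) = x + wordSum w := by simp [wordSum]

theorem wordSum_append (u w : List (Letter ω₁)) : wordSum (u ++ w) = wordSum u + wordSum w := by
  simp [wordSum]

theorem wordSum_mem (w : List (Letter ω₁)) : wordSum w ∈ AddSubgroup.zmultiples ω₁ := by
  induction w with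
  | nil => exact zero_mem _
  | cons x w ih => rw [wordSum_cons]; exact add_mem x.2.1 ih

open Classical in
/-- The monomial `V^w`: `V^∅ = 1` and `(ζ - (x + ŵ)) V̂^{x w}(ζ) = V^w₀ + ∫₀^ζ V̂^w`, where `ŵ` is
the sum of the letters of `w`. (The junk value `0` never occurs.) -/
noncomputable def monomial : List (Letter ω₁) → PowerSeries ℂ
  | [] => 1
  | x :: w => if h : ∃ φ' ∈ SimpleResurgent ω₁, IsHyperlogStep ω₁ (wordSum (x :: w)) (monomial w) φ'
    then h.choose else 0

theorem monomial_spec (hω₁ : ω₁ ≠ 0) (w : List (Letter ω₁)) :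
    monomial w ∈ SimpleResurgent ω₁ ∧ ResiduesOnlyAt ω₁ (wordSum w) (monomial w) ∧
      (w ≠ [] → PowerSeries.coeff 0 (monomial w) = 0) ∧
      ∀ x, IsHyperlogStep ω₁ (wordSum (x :: w)) (monomial w) (monomial (x :: w)) ∧
        monomial (x :: w) ∈ SimpleResurgent ω₁ := by
  have step : ∀ w : List (Letter ω₁), monomial w ∈ SimpleResurgent ω₁ →
      ResiduesOnlyAt ω₁ (wordSum w) (monomial w) →
      (w ≠ [] → PowerSeries.coeff 0 (monomial w) = 0) → ∀ x,
      IsHyperlogStep ω₁ (wordSum (x :: w)) (monomial w) (monomial (x :: w)) ∧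
        monomial (x :: w) ∈ SimpleResurgent ω₁ := by
    intro w h1 h2 h3 x
    have h : ∃ φ' ∈ SimpleResurgent ω₁, IsHyperlogStep ω₁ (wordSum (x :: w)) (monomial w) φ' := by
      refine exists_isHyperlogStep hω₁ h1 h2 (wordSum_mem _) ?_ fun h0 => h3 ?_
      · simpa using x.2.2
      · rintro rfl
        exact x.2.2 (by simpa using h0)
    rw [monomial, dif_pos h]
    exact ⟨h.choose_spec.2, h.choose_spec.1⟩
  induction w with
  | nil =>
    have h1 : monomial ([] : List (Letter ω₁)) ∈ SimpleResurgent ω₁ := by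
      rw [monomial]; exact one_mem
    have h2 : ResiduesOnlyAt ω₁ (wordSum ([] : List (Letter ω₁)))
        (monomial ([] : List (Letter ω₁))) := by
      rw [monomial]; exact residuesOnlyAt_one _
    exact ⟨h1, h2, fun h => absurd rfl h, step [] h1 h2 fun h => absurd rfl h⟩
  | cons x w ih =>
    obtain ⟨h1, h2, h3, h4⟩ := ih
    have h5 := (h4 x).1.residuesOnlyAt hω₁ h1 h2 (wordSum_mem _) (by simpa using x.2.2)
    exact ⟨(h4 x).2, h5, fun _ => (h4 x).1.coeff_zero,
      step _ (h4 x).2 h5 fun _ => (h4 x).1.coeff_zero⟩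

/-- The monomial `V^w` as an element of the space of simple resurgent series. -/
noncomputable def monomialMem (hω₁ : ω₁ ≠ 0) (w : List (Letter ω₁)) : SimpleResurgent ω₁ :=
  ⟨monomial w, (monomial_spec hω₁ w).1⟩

/-- A solution of `(-d/dz + q) θ' = z⁻¹ θ` is determined by its constant term (only for `q = 0` is
this term free). -/
theorem FormalStep.ext {q : ℂ} {θ θ₁ θ₂ : PowerSeries ℂ} (h₁ : FormalStep q θ θ₁)
    (h₂ : FormalStep q θ θ₂) (h0 : PowerSeries.coeff 0 θ₁ = PowerSeries.coeff 0 θ₂) : θ₁ = θ₂ := by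
  ext n
  induction n with
  | zero => exact h0
  | succ n ih =>
    by_cases hq : q = 0
    · have e1 := h₁.2 (n + 1)
      have e2 := h₂.2 (n + 1)
      rw [hq, zero_mul, add_zero] at e1 e2
      exact mul_left_cancel₀ (by exact_mod_cast n.succ_ne_zero) (e1.trans e2.symm)
    · have := (h₁.2 n).trans (h₂.2 n).symm
      rw [ih] at this
      exact mul_left_cancel₀ hq (add_left_cancel this)

/-- The operators `D ω` are the alien derivations of the lattice `ℤ ω₁`, computed along paths whose
half-circles have radius `δ |ω₁|`. -/
structure IsAlienSystem (ω₁ : ℂ) (δ : ℝ) (D : Letter ω₁ → Module.End ℂ (SimpleResurgent ω₁)) :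
    Prop where
  ne_zero : ω₁ ≠ 0
  pos : 0 < δ
  lt_half : δ < 1 / 2
  spec : ∀ (ω : Letter ω₁) (φ : SimpleResurgent ω₁) (ψ : PowerSeries ℂ),
    (D ω φ : PowerSeries ℂ) = ψ ↔ IsAlienDerivative ω₁ δ ω φ ψ

variable {δ : ℝ} {D : Letter ω₁ → Module.End ℂ (SimpleResurgent ω₁)}

/-- The constant term of `Δ_ω V^v`. -/
noncomputable def alienConst (D : Letter ω₁ → Module.End ℂ (SimpleResurgent ω₁)) (hω₁ : ω₁ ≠ 0)
    (ω : Letter ω₁) (v : List (Letter ω₁)) : ℂ :=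
  PowerSeries.coeff 0 (D ω (monomialMem hω₁ v) : PowerSeries ℂ)

theorem wordOp_cons {L V : Type*} [AddCommGroup V] [Module ℂ V] (D : L → Module.End ℂ V) (x : L)
    (w : List L) (v : V) : wordOp D (x :: w) v = wordOp D w (D x v) := by
  simp [wordOp]

theorem alienDerivation_monomial_nil (hD : IsAlienSystem ω₁ δ D) (ω : Letter ω₁) :
    D ω (monomialMem hD.ne_zero []) = 0 := by
  refine Subtype.ext (isAlienDerivative_one hD.ne_zero hD.pos hD.lt_half (ω := ω) ?_)
  exact (hD.spec ω (monomialMem hD.ne_zero []) _).1 rfl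

theorem formalStep_alienDerivation_monomial (hD : IsAlienSystem ω₁ δ D) (ω x : Letter ω₁)
    (w : List (Letter ω₁)) :
    FormalStep (ω - wordSum (x :: w)) (D ω (monomialMem hD.ne_zero w) : PowerSeries ℂ)
      (D ω (monomialMem hD.ne_zero (x :: w)) : PowerSeries ℂ) := by
  obtain ⟨-, h2, -, h4⟩ := monomial_spec hD.ne_zero w
  exact (h4 x).1.formalStep_alienDerivative hD.ne_zero hD.pos hD.lt_half h2 (wordSum_mem _)
    (by simpa using x.2.2) ((hD.spec ω (monomialMem hD.ne_zero w) _).1 rfl)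
    ((hD.spec ω (monomialMem hD.ne_zero (x :: w)) _).1 rfl)

theorem wordSum_eq_of_alienConst_ne_zero (hD : IsAlienSystem ω₁ δ D) {ω : Letter ω₁}
    {v : List (Letter ω₁)}
    (h : alienConst D hD.ne_zero ω v ≠ 0) : wordSum v = ω := by
  cases v with
  | nil =>
    rw [alienConst, alienDerivation_monomial_nil hD] at h
    simp at h
  | cons x w =>
    have := (formalStep_alienDerivation_monomial hD ω x w).1
    exact (sub_eq_zero.1 ((mul_eq_zero.1 this).resolve_right h)).symm

theorem alienConst_singleton_ne_zero (hD : IsAlienSystem ω₁ δ D) (x : Letter ω₁) :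
    alienConst D hD.ne_zero x [x] ≠ 0 := by
  have h := ((monomial_spec hD.ne_zero []).2.2.2 x).1
  rw [wordSum_cons, wordSum_nil, add_zero] at h
  have h1 : monomial ([] : List (Letter ω₁)) = 1 := by rw [monomial]
  rw [h1] at h
  exact h.coeff_zero_alienDerivative hD.ne_zero hD.pos hD.lt_half
    ((hD.spec x (monomialMem hD.ne_zero [x]) _).1 rfl)

/-- An alien derivation removes suffixes: `Δ_ω V^w = ∑_{w = u v, v ≠ ∅} C_ω(v) V^u`. Both sides
solve the same inhomogeneous relation `(-d/dz + q) θ = z⁻¹ Δ_ω V^{w'}`, `w'` being `w` without its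
first letter, and have the same constant term. -/
theorem alienDerivation_monomial (hD : IsAlienSystem ω₁ δ D) (ω : Letter ω₁)
    (w : List (Letter ω₁)) :
    D ω (monomialMem hD.ne_zero w) = ∑ k ∈ Finset.range w.length,
      alienConst D hD.ne_zero ω (w.drop k) • monomialMem hD.ne_zero (w.take k) := by
  induction w with
  | nil => simpa using alienDerivation_monomial_nil hD ω
  | cons x w ih =>
    have hF := formalStep_alienDerivation_monomial hD ω x w
    have hone : (monomialMem hD.ne_zero [] : PowerSeries ℂ) = 1 := by
      change monomial ([] : List (Letter ω₁)) = 1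
      rw [monomial]
    rw [List.length_cons, Finset.sum_range_succ']
    simp only [List.drop_succ_cons, List.take_succ_cons, List.drop_zero, List.take_zero]
    refine Subtype.ext (hF.ext ?_ ?_)
    · rw [ih]
      have h1 : FormalStep (ω - wordSum (x :: w)) 0
          ((alienConst D hD.ne_zero ω (x :: w) • monomialMem hD.ne_zero [] : SimpleResurgent ω₁) :
            PowerSeries ℂ) := by
        rw [Submodule.coe_smul, hone]
        refine ⟨by simpa [alienConst] using hF.1, fun n => ?_⟩
        cases n <;> simp [PowerSeries.coeff_one]
      have h2 : FormalStep (ω - wordSum (x :: w))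
          ((∑ k ∈ Finset.range w.length, alienConst D hD.ne_zero ω (w.drop k) •
            monomialMem hD.ne_zero (w.take k) : SimpleResurgent ω₁) : PowerSeries ℂ)
          ((∑ k ∈ Finset.range w.length, alienConst D hD.ne_zero ω (w.drop k) •
            monomialMem hD.ne_zero (x :: w.take k) : SimpleResurgent ω₁) : PowerSeries ℂ) := by
        simp only [AddSubmonoidClass.coe_finsetSum, Submodule.coe_smul]
        refine FormalStep.sum fun k _ => ?_
        by_cases hC : alienConst D hD.ne_zero ω (w.drop k) = 0
        · simp [hC, FormalStep]
        · have hsum := wordSum_eq_of_alienConst_ne_zero hD hC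
          have hq : (ω : ℂ) - wordSum (x :: w) = -wordSum (x :: w.take k) := by
            have := wordSum_append (w.take k) (w.drop k)
            rw [List.take_append_drop, hsum] at this
            rw [wordSum_cons, wordSum_cons, this]
            ring
          obtain ⟨k1, -, -, k4⟩ := monomial_spec hD.ne_zero (w.take k)
          rw [hq]
          exact ((k4 x).1.formalStep hD.ne_zero k1 (k4 x).2).smul _
      have h3 := FormalStep.sum (s := Finset.univ) (θ := ![_, _]) (θ' := ![_, _])
        (q := ω - wordSum (x :: w)) (fun i _ => by fin_cases i; exacts [h2, h1])
      simpa using h3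
    · rw [Submodule.coe_add, map_add, Submodule.coe_smul, hone, AddSubmonoidClass.coe_finsetSum,
        map_sum, Finset.sum_eq_zero fun k _ => ?_]
      · simp [alienConst]
      · rw [Submodule.coe_smul, map_smul]
        have := (monomial_spec hD.ne_zero (x :: w.take k)).2.2.1 (by simp)
        exact smul_eq_zero_of_right _ this

/-- On words of length at most `|w|`, the operator `Δ_w` detects the mirror image of `w`. -/
theorem wordOp_monomial (hD : IsAlienSystem ω₁ δ D) (w : List (Letter ω₁)) : ∃ K : ℂ, K ≠ 0 ∧
    wordOp D w (monomialMem hD.ne_zero w.reverse) = K • monomialMem hD.ne_zero [] ∧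
    ∀ u : List (Letter ω₁), u.length ≤ w.length → u ≠ w.reverse →
      wordOp D w (monomialMem hD.ne_zero u) = 0 := by
  induction w with
  | nil => exact ⟨1, one_ne_zero, by simp [wordOp], fun u hu hne =>
      absurd (List.eq_nil_of_length_eq_zero (by simpa using hu)) hne⟩
  | cons x w ih =>
    obtain ⟨K, hK, h1, h2⟩ := ih
    refine ⟨alienConst D hD.ne_zero x [x] * K,
      mul_ne_zero (alienConst_singleton_ne_zero hD x) hK, ?_, fun u hu hne => ?_⟩
    · rw [wordOp_cons, alienDerivation_monomial hD, map_sum, Finset.sum_eq_single w.length]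
      · have e1 : (x :: w).reverse.take w.length = w.reverse := by simp
        have e2 : (x :: w).reverse.drop w.length = [x] := by simp
        rw [map_smul, e1, e2, h1, smul_smul]
      · intro k hk hkne
        rw [map_smul, h2, smul_zero]
        · simp at hk ⊢
          omega
        · intro h
          have := congrArg List.length h
          simp at this hk
          omega
      · simp
    · rw [wordOp_cons, alienDerivation_monomial hD, map_sum]
      refine Finset.sum_eq_zero fun k hk => ?_
      rw [Finset.mem_range] at hk
      rw [List.length_cons] at hu
      rw [map_smul]
      by_cases ht : u.take k = w.reverse
      · have hl : k = w.length := by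
          have := congrArg List.length ht
          simp at this
          omega
        obtain ⟨y, hy⟩ : ∃ y, u.drop k = [y] := List.length_eq_one_iff.1 (by simp; omega)
        have hC : alienConst D hD.ne_zero x (u.drop k) = 0 := by
          by_contra hC
          have := wordSum_eq_of_alienConst_ne_zero hD hC
          rw [hy, wordSum_cons, wordSum_nil, add_zero] at this
          apply hne
          rw [← List.take_append_drop k u, ht, hy, Subtype.ext this, List.reverse_cons]
        rw [hC, zero_smul]
      · rw [h2 _ (by simp; omega) ht, smul_zero]

/-- Evaluation at the monomial of the mirror image of a shortest word `v` of the support leaves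
only the term `Φ^v Δ_v`. -/
theorem mouldExpansion_ne_zero (hD : IsAlienSystem ω₁ δ D)
    (Φ : List (Letter ω₁) →₀ SimpleResurgent ω₁) (hΦ : Φ ≠ 0) :
    mouldExpansion D Φ ≠ 0 := by
  obtain ⟨v, hv, hmin⟩ := Finset.exists_min_image Φ.support List.length
    (Finsupp.support_nonempty_iff.2 hΦ)
  obtain ⟨K, hK, h1, -⟩ := wordOp_monomial hD v
  intro h
  have h3 := LinearMap.congr_fun h (monomialMem hD.ne_zero v.reverse)
  rw [mouldExpansion, Finsupp.sum, LinearMap.sum_apply, Finset.sum_eq_single v] at h3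
  · have h4 : (Φ v : PowerSeries ℂ) * (K • 1) = 0 := by
      have : ((wordOp D v (monomialMem hD.ne_zero v.reverse) : SimpleResurgent ω₁) :
          PowerSeries ℂ) = K • 1 := by
        rw [h1, Submodule.coe_smul]
        change K • monomial ([] : List (Letter ω₁)) = _
        rw [monomial]
      rw [← this]
      exact h3
    rw [mul_smul_comm, mul_one] at h4
    exact (Finsupp.mem_support_iff.1 hv) (Subtype.ext ((smul_eq_zero.1 h4).resolve_left hK))
  · intro w hw hne
    obtain ⟨-, -, -, h5⟩ := wordOp_monomial hD w
    have h6 := h5 v.reverse (by simpa using hmin w hw) fun e => hne (List.reverse_injective e).symm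
    change (Φ w : PowerSeries ℂ) * ((wordOp D w (monomialMem hD.ne_zero v.reverse) :
      SimpleResurgent ω₁) : PowerSeries ℂ) = 0
    rw [h6]
    simp
  · intro h
    exact absurd hv h

end Monomials

end Resurgence

/-! ### The free Lie algebra inside the free associative algebra -/

namespace FreeLieAlgebra

theorem mem_of_forall_of_mem {R X : Type*} [CommRing R]
    (S : LieSubalgebra R (FreeLieAlgebra R X))
    (h : ∀ x, of R x ∈ S) (l : FreeLieAlgebra R X) : l ∈ S := by
  have : S.incl.comp (lift R fun x => (⟨of R x, h x⟩ : S)) = LieHom.id := by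
    ext x
    simp
  have h2 := LieHom.congr_fun this l
  simp only [LieHom.comp_apply, LieHom.id_apply] at h2
  rw [← h2]
  exact Subtype.property _

variable (K X : Type*) [Field K]

/-- The action of the free Lie algebra `L` on `K × L` in which a generator `x` sends `(c, m)` to
`(0, c x + [x, m])`. -/
noncomputable def affineGen (x : X) : Module.End K (K × FreeLieAlgebra K X) :=
  LinearMap.prod 0 (LinearMap.coprod (LinearMap.toSpanSingleton K _ (of K x))
    (LieAlgebra.ad K (FreeLieAlgebra K X) (of K x)))

/-- The extension of `affineGen` to a representation of the free Lie algebra. -/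
noncomputable def affineRep : FreeLieAlgebra K X →ₗ⁅K⁆ Module.End K (K × FreeLieAlgebra K X) :=
  lift K (affineGen K X)

/-- The map `l ↦ P(ι l)`, where `ι` is the morphism to the free associative algebra and `P` sends
`x₁ ⋯ xₙ` to `[x₁, [x₂, … xₙ]]`; it reads `P(ι l)` off the action on `(1, 0)`. It is the
derivation that fixes the generators. -/
noncomputable def euler : FreeLieAlgebra K X →ₗ[K] FreeLieAlgebra K X :=
  (LinearMap.snd K K _) ∘ₗ (LinearMap.applyₗ ((1 : K), (0 : FreeLieAlgebra K X))) ∘ₗ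
    (affineRep K X : FreeLieAlgebra K X →ₗ[K] _)

variable {K X}

theorem affineRep_of (x : X) : affineRep K X (of K x) = affineGen K X x := by
  simp [affineRep]

/-- On `L` the representation is the adjoint one, and it maps `(1, 0)` into `L`. -/
theorem affineRep_spec (l : FreeLieAlgebra K X) :
    (∀ m, affineRep K X l (0, m) = (0, ⁅l, m⁆)) ∧ (affineRep K X l (1, 0)).1 = 0 := by
  let S : LieSubalgebra K (FreeLieAlgebra K X) :=
    { carrier := {l | (∀ m, affineRep K X l (0, m) = (0, ⁅l, m⁆)) ∧ (affineRep K X l (1, 0)).1 = 0}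
      zero_mem' := by simp [← Prod.zero_eq_mk]
      add_mem' := by
        rintro a b ⟨ha, ha'⟩ ⟨hb, hb'⟩
        exact ⟨fun m => by simp [ha, hb], by simp [ha', hb']⟩
      smul_mem' := by
        rintro c a ⟨ha, ha'⟩
        exact ⟨fun m => by simp [ha], by simp [ha']⟩
      lie_mem' := by
        rintro a b ⟨ha, ha'⟩ ⟨hb, hb'⟩
        have key : ∀ c : FreeLieAlgebra K X, (affineRep K X c (1, 0)).1 = 0 →
            affineRep K X c (1, 0) = (0, (affineRep K X c (1, 0)).2) := fun c hc =>
          Prod.ext hc rfl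
        refine ⟨fun m => ?_, ?_⟩
        · simp [LieHom.map_lie, Ring.lie_def, ha, hb]
        · rw [LieHom.map_lie, Ring.lie_def, LinearMap.sub_apply, Module.End.mul_apply,
            Module.End.mul_apply, key a ha', key b hb', ha, hb]
          simp }
  exact mem_of_forall_of_mem S (fun x => by
    change (∀ m, _) ∧ _
    rw [affineRep_of]
    simp [affineGen]) l

theorem affineRep_one (l : FreeLieAlgebra K X) : affineRep K X l (1, 0) = (0, euler K X l) :=
  Prod.ext (affineRep_spec l).2 rfl

theorem euler_of (x : X) : euler K X (of K x) = of K x := by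
  have := affineRep_one (K := K) (of K x)
  rw [affineRep_of] at this
  simpa [affineGen] using (congrArg Prod.snd this).symm

theorem euler_lie (l m : FreeLieAlgebra K X) :
    euler K X ⁅l, m⁆ = ⁅l, euler K X m⁆ + ⁅euler K X l, m⁆ := by
  have h := affineRep_one ⁅l, m⁆
  rw [LieHom.map_lie, Ring.lie_def, LinearMap.sub_apply, Module.End.mul_apply,
    Module.End.mul_apply, affineRep_one, affineRep_one, (affineRep_spec l).1,
    (affineRep_spec m).1] at h
  have h2 := (congrArg Prod.snd h).symm
  simp only [Prod.mk_sub_mk] at h2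
  rw [h2, ← lie_skew m, sub_neg_eq_add]

/-- A Lie element is a sum of homogeneous ones, on which `euler` is multiplication by the
degree. -/
theorem mem_iSup_eigenspace_euler (l : FreeLieAlgebra K X) :
    l ∈ ⨆ n : ℕ, Module.End.eigenspace (euler K X) ((n : K) + 1) := by
  let S : LieSubalgebra K (FreeLieAlgebra K X) :=
    { (⨆ n : ℕ, Module.End.eigenspace (euler K X) ((n : K) + 1) :
        Submodule K (FreeLieAlgebra K X)) with
      lie_mem' := by
        intro a b ha hb
        simp only [AddSubsemigroup.mem_carrier, AddSubmonoid.mem_toSubsemigroup,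
          Submodule.mem_toAddSubmonoid] at ha hb ⊢
        refine Submodule.iSup_induction _ (motive := fun a => ⁅a, b⁆ ∈ ⨆ n : ℕ,
          Module.End.eigenspace (euler K X) ((n : K) + 1)) ha (fun i x hx => ?_) (by simp)
          (fun x y hx hy => by rw [add_lie]; exact add_mem hx hy)
        refine Submodule.iSup_induction _ (motive := fun b => ⁅x, b⁆ ∈ ⨆ n : ℕ,
          Module.End.eigenspace (euler K X) ((n : K) + 1)) hb (fun j y hy => ?_) (by simp)
          (fun x y hx hy => by rw [lie_add]; exact add_mem hx hy)
        refine Submodule.mem_iSup_of_mem (i + j + 1) ?_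
        rw [Module.End.mem_eigenspace_iff] at hx hy ⊢
        rw [euler_lie, hx, hy, lie_smul, smul_lie, ← add_smul]
        congr 1
        push_cast
        ring }
  refine mem_of_forall_of_mem S (fun x => ?_) l
  refine Submodule.mem_iSup_of_mem
    (p := fun n : ℕ => Module.End.eigenspace (euler K X) ((n : K) + 1)) 0 ?_
  rw [Module.End.mem_eigenspace_iff, euler_of]
  simp

theorem euler_injective [CharZero K] : Function.Injective (euler K X) := by
  rw [← LinearMap.ker_eq_bot, ← Module.End.eigenspace_zero]
  have h := (Module.End.eigenspaces_iSupIndep (euler K X)) 0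
  rw [Submodule.eq_bot_iff]
  intro l hl
  refine Submodule.disjoint_def.1 h l hl (?_ : l ∈ _)
  have h2 := mem_iSup_eigenspace_euler l
  have h3 : ∀ n : ℕ, Module.End.eigenspace (euler K X) ((n : K) + 1) ≤
      ⨆ (μ : K) (_ : μ ≠ 0), Module.End.eigenspace (euler K X) μ := fun n => ?_
  · exact iSup_le h3 h2
  exact le_iSup₂_of_le ((n : K) + 1) (by exact_mod_cast Nat.succ_ne_zero n) le_rfl

/-- In characteristic zero the free Lie algebra embeds into the free associative algebra: right
bracketing is, up to the degree, a left inverse (Dynkin, Specht, Wever). -/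
theorem lift_ι_injective [CharZero K] :
    Function.Injective (lift K (FreeAlgebra.ι K : X → FreeAlgebra K X)) := by
  have h : ((FreeAlgebra.lift K (affineGen K X) : FreeAlgebra K X →ₐ[K] _) :
      FreeAlgebra K X →ₗ⁅K⁆ _).comp (lift K (FreeAlgebra.ι K)) = affineRep K X := by
    ext1 x
    rw [affineRep_of]
    simp
  intro l m hlm
  apply euler_injective
  have h1 : affineRep K X l = affineRep K X m := by
    rw [← h, LieHom.comp_apply, LieHom.comp_apply, hlm]
  have := affineRep_one l
  rw [h1, affineRep_one] at this
  exact (congrArg Prod.snd this).symm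

end FreeLieAlgebra

namespace Resurgence

/-! ### Freeness from linear independence of the words -/

theorem lift_basisFreeMonoid {L V : Type*} [AddCommGroup V] [Module ℂ V] (D : L → Module.End ℂ V)
    (w : FreeMonoid L) : FreeAlgebra.lift ℂ D (FreeAlgebra.basisFreeMonoid ℂ L w) =
      wordOp D (FreeMonoid.toList w).reverse := by
  rw [wordOp, List.reverse_reverse]
  simp [FreeAlgebra.basisFreeMonoid, FreeAlgebra.equivMonoidAlgebraFreeMonoid,
    FreeMonoid.lift_apply, map_list_prod, Function.comp_def]


variable {ω₁ : ℂ} (D : Letter ω₁ → Module.End ℂ (SimpleResurgent ω₁))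

open Classical in
/-- Left linear independence of the words over the resurgent series, in the form of tensors. -/
theorem lift_leftMul_freeAlgebra_injective
    (h : ∀ Φ : List (Letter ω₁) →₀ SimpleResurgent ω₁, Φ ≠ 0 → mouldExpansion D Φ ≠ 0) :
    Function.Injective
      (TensorProduct.lift (leftMul.compl₂ (FreeAlgebra.lift ℂ D).toLinearMap)) := by
  rw [injective_iff_map_eq_zero]
  intro z hz
  by_contra hne
  set e := TensorProduct.equivFinsuppOfBasisRight (M := SimpleResurgent ω₁)
    (FreeAlgebra.basisFreeMonoid ℂ (Letter ω₁))
  have he : e z ≠ 0 := by simpa using hne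
  let r : FreeMonoid (Letter ω₁) ↪ List (Letter ω₁) :=
    ⟨fun w => (FreeMonoid.toList w).reverse, fun a b hab => by simpa using hab⟩
  refine h ((e z).embDomain r) (by simpa using he) ?_
  rw [mouldExpansion, Finsupp.sum_embDomain, ← hz]
  conv_rhs => rw [← e.symm_apply_apply z]
  rw [TensorProduct.equivFinsuppOfBasisRight_symm_apply, Finsupp.sum, Finsupp.sum, map_sum]
  refine Finset.sum_congr rfl fun w _ => ?_
  rw [TensorProduct.lift.tmul, LinearMap.compl₂_apply, AlgHom.toLinearMap_apply,
    lift_basisFreeMonoid]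
  rfl

open Classical in
/-- Tensors `1 ⊗ a` give the operators with constant coefficients. -/
theorem freeAlgebra_lift_injective
    (h : ∀ Φ : List (Letter ω₁) →₀ SimpleResurgent ω₁, Φ ≠ 0 → mouldExpansion D Φ ≠ 0) :
    Function.Injective (FreeAlgebra.lift ℂ D) := by
  rw [injective_iff_map_eq_zero]
  intro a ha
  have h1 := lift_leftMul_freeAlgebra_injective D h
  rw [injective_iff_map_eq_zero] at h1
  have h2 := h1 ((⟨1, one_mem⟩ : SimpleResurgent ω₁) ⊗ₜ a) (by
    rw [TensorProduct.lift.tmul, LinearMap.compl₂_apply, AlgHom.toLinearMap_apply, ha, map_zero])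
  have h3 : (⟨1, one_mem⟩ : SimpleResurgent ω₁) ≠ 0 := by
    simp [Subtype.ext_iff]
  refine (FreeAlgebra.basisFreeMonoid ℂ (Letter ω₁)).repr.map_eq_zero_iff.1 ?_
  ext w
  have h4 := congrArg (fun z => TensorProduct.equivFinsuppOfBasisRight
    (FreeAlgebra.basisFreeMonoid ℂ (Letter ω₁)) z w) h2
  rw [TensorProduct.equivFinsuppOfBasisRight_apply_tmul_apply, map_zero] at h4
  simpa [h3] using h4

theorem freeLie_lift_eq : (FreeLieAlgebra.lift ℂ D) =
    ((FreeAlgebra.lift ℂ D : FreeAlgebra ℂ (Letter ω₁) →ₐ[ℂ] _) :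
      FreeAlgebra ℂ (Letter ω₁) →ₗ⁅ℂ⁆ _).comp (FreeLieAlgebra.lift ℂ (FreeAlgebra.ι ℂ)) := by
  ext1 x
  simp

theorem freeLieAlgebra_lift_injective
    (h : ∀ Φ : List (Letter ω₁) →₀ SimpleResurgent ω₁, Φ ≠ 0 → mouldExpansion D Φ ≠ 0) :
    Function.Injective (FreeLieAlgebra.lift ℂ D) := by
  rw [freeLie_lift_eq]
  exact (freeAlgebra_lift_injective D h).comp FreeLieAlgebra.lift_ι_injective

theorem lift_leftMul_freeLieAlgebra_injective
    (h : ∀ Φ : List (Letter ω₁) →₀ SimpleResurgent ω₁, Φ ≠ 0 → mouldExpansion D Φ ≠ 0) :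
    Function.Injective (TensorProduct.lift (leftMul.compl₂
        (FreeLieAlgebra.lift ℂ D : FreeLieAlgebra ℂ (Letter ω₁) →ₗ[ℂ]
          Module.End ℂ (SimpleResurgent ω₁)))) := by
  have h1 := lift_leftMul_freeAlgebra_injective D h
  have h2 := Module.Flat.lTensor_preserves_injective_linearMap (M := SimpleResurgent ω₁)
    (FreeLieAlgebra.lift ℂ (FreeAlgebra.ι ℂ : Letter ω₁ → FreeAlgebra ℂ (Letter ω₁)) :
      FreeLieAlgebra ℂ (Letter ω₁) →ₗ⁅ℂ⁆ _).toLinearMap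
    (FreeLieAlgebra.lift_ι_injective (K := ℂ))
  convert h1.comp h2
  rw [← LinearMap.coe_comp]
  congr 1
  ext c l : 3
  simp [freeLie_lift_eq]

end Resurgence

theorem mainTheorem2 (ω₁ : ℂ) (hω₁ : ω₁ ≠ 0) (δ : ℝ) (hδ₀ : 0 < δ) (hδ : δ < 1 / 2) :
    ∃ D : Resurgence.Letter ω₁ → Module.End ℂ (Resurgence.SimpleResurgent ω₁),
      (∀ (ω : Resurgence.Letter ω₁) (φ : Resurgence.SimpleResurgent ω₁) (ψ : PowerSeries ℂ),
        (D ω φ : PowerSeries ℂ) = ψ ↔ Resurgence.IsAlienDerivative ω₁ δ ω φ ψ) ∧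
      (∀ Φ : List (Resurgence.Letter ω₁) →₀ Resurgence.SimpleResurgent ω₁,
        Φ ≠ 0 → Resurgence.mouldExpansion D Φ ≠ 0) ∧
      Function.Injective (FreeAlgebra.lift ℂ D) ∧
      Function.Injective (FreeLieAlgebra.lift ℂ D) ∧
      Function.Injective (TensorProduct.lift (Resurgence.leftMul.compl₂
        (FreeLieAlgebra.lift ℂ D : FreeLieAlgebra ℂ (Resurgence.Letter ω₁) →ₗ[ℂ]
          Module.End ℂ (Resurgence.SimpleResurgent ω₁)))) := by
  obtain ⟨D, hspec⟩ := Resurgence.exists_alienDerivation hω₁ hδ₀ hδ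
  have hD : Resurgence.IsAlienSystem ω₁ δ D := ⟨hω₁, hδ₀, hδ, hspec⟩
  have h := Resurgence.mouldExpansion_ne_zero hD
  exact ⟨D, hspec, h, Resurgence.freeAlgebra_lift_injective D h,
    Resurgence.freeLieAlgebra_lift_injective D h,
    Resurgence.lift_leftMul_freeLieAlgebra_injective D h⟩
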